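/- Corollary 3.11 (uniquely hamiltonian multigraphs). Multigraphs are finite, may have parallel edges and have no loops. A hamiltonian cycle is regarded as a set of edges (so cycles using different parallel edges are different), and a multigraph is uniquely hamiltonian if it has exactly one hamiltonian cycle. The degree set of a multigraph $G$ with vertex set $V$ is $M_{deg}(G)=\{\deg(v) : v\in V\}$. Let $M$ be a finite set of natural numbers $d\ge 2$. There is a uniquely hamiltonian multigraph $G$ with $M_{deg}(G)=M$ if and only if $M$ contains an even number. In that case there are infinitely many pairwise non-isomorphic uniquely hamiltonian multigraphs $G$ with $M_{deg}(G)=M$ that are $3$-connected if $2\notin M$, and infinitely many that are $2$-connected if $2\in M$. -/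

import Mathlib

namespace Graph

/-- A multigraph: finitely many vertices and edges, parallel edges allowed, no loops. -/
structure IsMultigraph {α β : Type*} (G : Graph α β) : Prop where
  finite_vertexSet : G.vertexSet.Finite
  finite_edgeSet : G.edgeSet.Finite
  loopless : G.Loopless

/-- The degree of a vertex in a loopless multigraph: the number of edges incident with it,
parallel edges being counted separately. -/
noncomputable def degree {α β : Type*} (G : Graph α β) (x : α) : ℕ :=
  (G.incidenceSet x).ncard

/-- The set of the degrees of all vertices. -/
def degreeSet {α β : Type*} (G : Graph α β) : Set ℕ :=
  {d | ∃ x ∈ G.vertexSet, G.degree x = d}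

/-- `C` is the edge set of a hamiltonian cycle: the vertices of `G` can be arranged in a cyclic
order `v 0, …, v (n - 1)` without repetition such that `C` consists of `n` distinct edges `e i`,
where `e i` joins `v i` and `v (i + 1)` (indices modulo `n`). Cycles through different parallel
edges have different edge sets; two parallel edges form a cycle of length `2`. -/
def IsHamiltonianCycle {α β : Type*} (G : Graph α β) (C : Set β) : Prop :=
  ∃ n : ℕ, 2 ≤ n ∧ ∃ (v : ZMod n → α) (e : ZMod n → β),
    Function.Injective v ∧ Set.range v = G.vertexSet ∧
    Function.Injective e ∧ Set.range e = C ∧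
    ∀ i, G.IsLink (e i) (v i) (v (i + 1))

/-- There is exactly one hamiltonian cycle. -/
def IsUniquelyHamiltonian {α β : Type*} (G : Graph α β) : Prop :=
  ∃! C : Set β, G.IsHamiltonianCycle C

/-- There is a vertex, and any two vertices are joined by a path. -/
def IsConnected {α β : Type*} (G : Graph α β) : Prop :=
  G.vertexSet.Nonempty ∧
    ∀ x ∈ G.vertexSet, ∀ y ∈ G.vertexSet, Relation.ReflTransGen G.Adj x y

/-- `k`-connectedness: more than `k` vertices, and the deletion of fewer than `k` vertices
always leaves a connected graph. -/
def IsKConnected {α β : Type*} (G : Graph α β) (k : ℕ) : Prop :=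
  (k : ℕ∞) < G.vertexSet.encard ∧
    ∀ X : Finset α, X.card < k → (G.deleteVerts (X : Set α)).IsConnected

/-- Isomorphism of multigraphs: bijections of the vertices and of the edges which respect
incidence. -/
def IsIsomorphic {α β α' β' : Type*} (G : Graph α β) (H : Graph α' β') : Prop :=
  ∃ (f : G.vertexSet ≃ H.vertexSet) (g : G.edgeSet ≃ H.edgeSet),
    ∀ (e : G.edgeSet) (x y : G.vertexSet),
      G.IsLink (e : β) (x : α) (y : α) ↔ H.IsLink (g e : β') (f x : α') (f y : α')

end Graph

/-- `G` is a uniquely hamiltonian multigraph whose degree set is exactly `M`. -/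
def IsUHMultigraphWithDegrees {α β : Type*} (G : Graph α β) (M : Finset ℕ) : Prop :=
  G.IsMultigraph ∧ G.IsUniquelyHamiltonian ∧ G.degreeSet = (M : Set ℕ)

/-- There are infinitely many pairwise non-isomorphic `k`-connected uniquely hamiltonian
multigraphs with degree set `M`. (Every finite multigraph is isomorphic to one whose vertices
and edges are natural numbers.) -/
def InfinitelyManyKConnectedUH (k : ℕ) (M : Finset ℕ) : Prop :=
  ∃ G : ℕ → Graph ℕ ℕ,
    (∀ i, IsUHMultigraphWithDegrees (G i) M ∧ (G i).IsKConnected k) ∧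
    ∀ i j, i ≠ j → ¬ (G i).IsIsomorphic (G j)

/-! Necessity is Thomason's lollipop argument. Fix a vertex `x` and an edge `a` at it. A lollipop is
a hamiltonian path that begins with `a` at `x`, plus one more edge at its last vertex. A path ending
at `y` extends to `deg y - 1` lollipops, so if all degrees are odd the number of lollipops is even.
If the extra edge ends at an inner vertex, exchanging it with the path edge that follows this vertex
is a fixed-point-free involution. Hence the remaining lollipops, which are the hamiltonian cycles
through `a`, are even in number (`even_card_closed_lollipops`), and there cannot be exactly one.

Sufficiency starts from a base graph whose only hamiltonian cycle has simple edges, with a root `v`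
that has simple edges to its neighbours `a`, `b` on the cycle and at most one further neighbour `c`.
The root is replaced by a triangle in which the side opposite to `v` has multiplicity `k`.
Contracting the triangle takes spanning cycles to spanning cycles, and nothing is lost, because the
two exits that a cycle uses determine its route through the triangle. So uniqueness persists, the
cycle avoids the side of multiplicity `k`, two vertices of degree `k + 2` appear, and no old degree
changes (`IsRooted.isRooted_expand`, `IsRooted.multDegree_image_expand`). If `k ≠ 0` and `c` is a
neighbour of the root, 3-connectedness persists too. Iteration produces every degree in `M`, and
repeating a degree gives graphs of arbitrarily large order.

The base is a triangle if `2 ∈ M`. Otherwise, for an even `2 * r + 2 ∈ M`, it is a 28-cycle with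
weighted chords, where a finite search, independent of `r`, verifies uniqueness and 3-connectedness.
-/

open Set

/-! ### Hamiltonian cycles as sequences indexed by natural numbers -/

namespace Graph

variable {α β : Type*} {G : Graph α β}

/-- A hamiltonian cycle listed by natural numbers: `v 0, …, v (n - 1)` are the vertices and
`e i` joins `v i` to its successor. -/
structure IsCycleSeq (G : Graph α β) (n : ℕ) (v : ℕ → α) (e : ℕ → β) : Prop where
  two_le : 2 ≤ n
  inj_vertex : InjOn v (Iio n)
  image_vertex : v '' Iio n = G.vertexSet
  inj_edge : InjOn e (Iio n)
  link : ∀ i, i + 1 < n → G.IsLink (e i) (v i) (v (i + 1))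
  link_last : G.IsLink (e (n - 1)) (v (n - 1)) (v 0)

lemma image_Iio_natCast {γ : Type*} (n : ℕ) [NeZero n] (f : ZMod n → γ) :
    (fun i : ℕ => f i) '' Iio n = range f := by
  ext y
  constructor
  · rintro ⟨i, -, rfl⟩; exact ⟨_, rfl⟩
  · rintro ⟨i, rfl⟩; exact ⟨i.val, ZMod.val_lt i, by simp⟩

lemma range_comp_val {γ : Type*} (n : ℕ) [NeZero n] (f : ℕ → γ) :
    range (fun i : ZMod n => f i.val) = f '' Iio n := by
  ext y
  constructor
  · rintro ⟨i, rfl⟩; exact ⟨i.val, ZMod.val_lt i, rfl⟩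
  · rintro ⟨i, hi, rfl⟩; exact ⟨i, by simp only [ZMod.val_natCast, Nat.mod_eq_of_lt hi]⟩

lemma IsHamiltonianCycle.exists_isCycleSeq {C : Set β} (h : G.IsHamiltonianCycle C) :
    ∃ n v e, G.IsCycleSeq n v e ∧ e '' Iio n = C := by
  obtain ⟨n, hn, v, e, hv, hvr, he, her, hl⟩ := h
  have : NeZero n := ⟨by omega⟩
  have hinj : InjOn (fun i : ℕ => (i : ZMod n)) (Iio n) := by
    intro i hi j hj hij
    have := (ZMod.natCast_eq_natCast_iff' i j n).1 hij
    rwa [Nat.mod_eq_of_lt hi, Nat.mod_eq_of_lt hj] at this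
  refine ⟨n, fun i => v i, fun i => e i, ⟨hn, ?_, ?_, ?_, ?_, ?_⟩, ?_⟩
  · exact fun i hi j hj hij => hinj hi hj (hv hij)
  · rw [← hvr, ← image_Iio_natCast]
  · exact fun i hi j hj hij => hinj hi hj (he hij)
  · intro i _
    have := hl (i : ZMod n)
    push_cast
    exact this
  · have := hl ((n - 1 : ℕ) : ZMod n)
    have h0 : ((n - 1 : ℕ) : ZMod n) + 1 = ((0 : ℕ) : ZMod n) := by
      have : ((n - 1 + 1 : ℕ) : ZMod n) = 0 := by
        rw [Nat.sub_add_cancel (by omega)]; simp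
      push_cast at this ⊢
      exact this
    rw [h0] at this
    exact this
  · rw [← her, ← image_Iio_natCast]

lemma IsCycleSeq.isHamiltonianCycle {n : ℕ} {v : ℕ → α} {e : ℕ → β} (h : G.IsCycleSeq n v e) :
    G.IsHamiltonianCycle (e '' Iio n) := by
  have hn := h.two_le
  have : NeZero n := ⟨by omega⟩
  refine ⟨n, hn, fun i => v i.val, fun i => e i.val, ?_, ?_, ?_, ?_, ?_⟩
  · exact fun i j hij => ZMod.val_injective n (h.inj_vertex (ZMod.val_lt i) (ZMod.val_lt j) hij)
  · rw [range_comp_val, h.image_vertex]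
  · exact fun i j hij => ZMod.val_injective n (h.inj_edge (ZMod.val_lt i) (ZMod.val_lt j) hij)
  · rw [range_comp_val]
  · intro i
    have hi := ZMod.val_lt i
    have h1 : (i + 1).val = (i.val + 1) % n := by
      rw [ZMod.val_add, ZMod.val_one_eq_one_mod, Nat.mod_eq_of_lt (show 1 < n by omega)]
    simp only [h1]
    by_cases hlt : i.val + 1 < n
    · rw [Nat.mod_eq_of_lt hlt]; exact h.link _ hlt
    · have : i.val = n - 1 := by omega
      rw [this, Nat.sub_add_cancel (by omega), Nat.mod_self]
      exact h.link_last

/-! ### Lollipops and the parity of hamiltonian cycles -/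

/-- Reversal of the segment `j, …, n - 1`. -/
def reverseFrom (n j i : ℕ) : ℕ := if j ≤ i ∧ i < n then n - 1 + j - i else i

lemma reverseFrom_reverseFrom (n j i : ℕ) : reverseFrom n j (reverseFrom n j i) = i := by
  unfold reverseFrom; split_ifs <;> omega

lemma reverseFrom_of_lt {n j i : ℕ} (h : i < j) : reverseFrom n j i = i := by
  unfold reverseFrom; split_ifs <;> omega

lemma reverseFrom_of_le {n j i : ℕ} (h : j ≤ i) (h' : i < n) :
    reverseFrom n j i = n - 1 + j - i := by
  unfold reverseFrom; split_ifs <;> omega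

lemma reverseFrom_of_ge {n j i : ℕ} (h : n ≤ i) : reverseFrom n j i = i := by
  unfold reverseFrom; split_ifs <;> omega

lemma reverseFrom_lt {n j i : ℕ} (h : i < n) : reverseFrom n j i < n := by
  unfold reverseFrom; split_ifs <;> omega

lemma image_comp_reverseFrom {γ : Type*} (n j : ℕ) (f : ℕ → γ) :
    (f ∘ reverseFrom n j) '' Iio n = f '' Iio n := by
  rw [image_comp]
  congr 1
  ext i
  constructor
  · rintro ⟨k, hk, rfl⟩; exact reverseFrom_lt hk
  · intro hi; exact ⟨_, reverseFrom_lt hi, reverseFrom_reverseFrom n j i⟩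

lemma injOn_comp_reverseFrom {γ : Type*} {n j : ℕ} {f : ℕ → γ} (h : InjOn f (Iio n)) :
    InjOn (f ∘ reverseFrom n j) (Iio n) := by
  intro i hi k hk hik
  have := h (reverseFrom_lt hi) (reverseFrom_lt hk) hik
  rw [← reverseFrom_reverseFrom n j i, this, reverseFrom_reverseFrom]

/-- A hamiltonian path `v 0, …, v (n - 1)` with edges `e 0, …, e (n - 2)` which starts with the
edge `a` at `x`, together with a further edge `e (n - 1)` at its last vertex. -/
structure IsLollipop (G : Graph α β) (n : ℕ) (x : α) (a : β) (p : (ℕ → α) × (ℕ → β)) : Prop where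
  inj_vertex : InjOn p.1 (Iio n)
  image_vertex : p.1 '' Iio n = G.vertexSet
  inj_edge : InjOn p.2 (Iio n)
  link : ∀ i, i + 1 < n → G.IsLink (p.2 i) (p.1 i) (p.1 (i + 1))
  inc_last : G.Inc (p.2 (n - 1)) (p.1 (n - 1))
  vertex_zero : p.1 0 = x
  edge_zero : p.2 0 = a
  const : ∀ i, n ≤ i → p.1 i = x ∧ p.2 i = a

variable {n : ℕ} {x : α} {a : β} {p : (ℕ → α) × (ℕ → β)}

lemma IsLollipop.exists_end (h : G.IsLollipop n x a p) :
    ∃ j < n, G.IsLink (p.2 (n - 1)) (p.1 (n - 1)) (p.1 j) := by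
  obtain ⟨y, hy⟩ := h.inc_last
  have := hy.right_mem
  rw [← h.image_vertex] at this
  obtain ⟨j, hj, rfl⟩ := this
  exact ⟨j, hj, hy⟩

open Classical in
/-- The position of the second end of the last edge of a lollipop. -/
noncomputable def lollipopEnd (G : Graph α β) (n : ℕ) (p : (ℕ → α) × (ℕ → β)) : ℕ :=
  if h : ∃ j < n, G.IsLink (p.2 (n - 1)) (p.1 (n - 1)) (p.1 j) then h.choose else 0

lemma IsLollipop.lollipopEnd_spec (h : G.IsLollipop n x a p) :
    G.lollipopEnd n p < n ∧
      G.IsLink (p.2 (n - 1)) (p.1 (n - 1)) (p.1 (G.lollipopEnd n p)) := by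
  have h' := h.exists_end
  rw [lollipopEnd, dif_pos h']
  exact h'.choose_spec

lemma IsLollipop.lollipopEnd_eq (h : G.IsLollipop n x a p) {j : ℕ} (hj : j < n)
    (hl : G.IsLink (p.2 (n - 1)) (p.1 (n - 1)) (p.1 j)) : G.lollipopEnd n p = j :=
  h.inj_vertex h.lollipopEnd_spec.1 hj (h.lollipopEnd_spec.2.right_unique hl)

/-- The lollipop exchange. -/
noncomputable def lollipopSwap (G : Graph α β) (n : ℕ) (p : (ℕ → α) × (ℕ → β)) :
    (ℕ → α) × (ℕ → β) :=
  (p.1 ∘ reverseFrom n (G.lollipopEnd n p + 1), p.2 ∘ reverseFrom n (G.lollipopEnd n p))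

lemma IsLollipop.end_lt (hG : G.Loopless) (h : G.IsLollipop n x a p) :
    G.lollipopEnd n p + 1 < n := by
  obtain ⟨h1, h2⟩ := h.lollipopEnd_spec
  rcases Nat.lt_or_ge (G.lollipopEnd n p + 1) n with h3 | h3
  · exact h3
  · have : G.lollipopEnd n p = n - 1 := by omega
    rw [this] at h2
    exact (hG.not_isLoopAt _ _ h2).elim

/-- An end at position `0` is excluded because the reversal of the edges would then move the first
edge `a`. -/
lemma IsLollipop.swap (hG : G.Loopless) (h : G.IsLollipop n x a p) (h0 : G.lollipopEnd n p ≠ 0) :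
    G.IsLollipop n x a (G.lollipopSwap n p) := by
  have hlt := h.end_lt hG
  have hl := h.lollipopEnd_spec.2
  unfold lollipopSwap
  set j := G.lollipopEnd n p
  refine ⟨injOn_comp_reverseFrom h.inj_vertex, ?_, injOn_comp_reverseFrom h.inj_edge, ?_, ?_, ?_,
    ?_, ?_⟩
  · rw [image_comp_reverseFrom, h.image_vertex]
  · intro i hi
    simp only [Function.comp]
    rcases lt_trichotomy i j with hij | rfl | hij
    · rw [reverseFrom_of_lt hij, reverseFrom_of_lt (by omega), reverseFrom_of_lt (by omega)]
      exact h.link i hi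
    · rw [reverseFrom_of_le le_rfl (by omega), reverseFrom_of_lt (by omega),
        reverseFrom_of_le le_rfl (by omega)]
      simp only [Nat.add_sub_cancel]
      exact hl.symm
    · rw [reverseFrom_of_le (by omega) (by omega), reverseFrom_of_le (by omega) (by omega),
        reverseFrom_of_le (by omega) (by omega)]
      have := (h.link (n - 1 + j - i) (by omega)).symm
      convert this using 2 <;> omega
  · simp only [Function.comp]
    rw [reverseFrom_of_le (by omega) (by omega), reverseFrom_of_le (by omega) (by omega)]
    have := (h.link j hlt).symm.inc_left
    convert this using 2 <;> omega
  · simp only [Function.comp]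
    rw [reverseFrom_of_lt (by omega), h.vertex_zero]
  · simp only [Function.comp]
    rw [reverseFrom_of_lt (by omega), h.edge_zero]
  · intro i hi
    simp only [Function.comp]
    rw [reverseFrom_of_ge hi, reverseFrom_of_ge hi]
    exact h.const i hi

/-- The old vertex `j + 1` becomes the last one and the old path edge `j` becomes the extra edge, so
it ends at position `j` again. This makes the exchange an involution. -/
lemma IsLollipop.end_swap (hG : G.Loopless) (h : G.IsLollipop n x a p)
    (h0 : G.lollipopEnd n p ≠ 0) :
    G.lollipopEnd n (G.lollipopSwap n p) = G.lollipopEnd n p := by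
  have hlt := h.end_lt hG
  refine (h.swap hG h0).lollipopEnd_eq (by omega) ?_
  simp only [lollipopSwap, Function.comp]
  set j := G.lollipopEnd n p
  rw [reverseFrom_of_le (by omega) (by omega), reverseFrom_of_le (by omega) (by omega),
    reverseFrom_of_lt (by omega)]
  have := (h.link j hlt).symm
  convert this using 2 <;> omega

lemma IsLollipop.swap_swap (hG : G.Loopless) (h : G.IsLollipop n x a p)
    (h0 : G.lollipopEnd n p ≠ 0) :
    G.lollipopSwap n (G.lollipopSwap n p) = p := by
  have := h.end_swap hG h0
  rw [lollipopSwap, this]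
  ext i <;> simp [lollipopSwap, reverseFrom_reverseFrom]

/-- The extra edge always changes, even for `j = n - 2`, where two parallel edges trade places and
all vertices stay. -/
lemma IsLollipop.swap_ne (hG : G.Loopless) (h : G.IsLollipop n x a p) :
    G.lollipopSwap n p ≠ p := by
  have hlt := h.end_lt hG
  intro heq
  have := congrFun (congrArg Prod.snd heq) (n - 1)
  simp only [lollipopSwap, Function.comp] at this
  rw [reverseFrom_of_le (by omega) (by omega)] at this
  have := h.inj_edge (show n - 1 + G.lollipopEnd n p - (n - 1) < n by omega)
    (show n - 1 < n by omega) this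
  omega

/-- The field `const` fixes both sequences from `n` on, so a lollipop is determined by finitely many
values. -/
lemma finite_setOf_isLollipop (hG : G.IsMultigraph) (n : ℕ) (x : α) (a : β) :
    {p | G.IsLollipop n x a p}.Finite := by
  have hfin : ((Set.univ.pi fun _ : Fin n => G.vertexSet) ×ˢ
      (Set.univ.pi fun _ : Fin n => G.edgeSet)).Finite :=
    (Set.Finite.pi' fun _ => hG.finite_vertexSet).prod (Set.Finite.pi' fun _ => hG.finite_edgeSet)
      |>.subset (by intro p; simp)
  refine Set.Finite.of_injOn (f := fun p : (ℕ → α) × (ℕ → β) =>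
    ((fun i : Fin n => p.1 i), (fun i : Fin n => p.2 i))) ?_ ?_ hfin
  · intro p hp
    refine ⟨fun i _ => ?_, fun i _ => ?_⟩
    · rw [← hp.image_vertex]; exact ⟨i, i.2, rfl⟩
    · show p.2 i ∈ G.edgeSet
      by_cases hi : (i : ℕ) + 1 < n
      · exact (hp.link _ hi).edge_mem
      · have : (i : ℕ) = n - 1 := by omega
        rw [this]; exact hp.inc_last.edge_mem
  · intro p hp q hq hpq
    simp only [Prod.mk.injEq, funext_iff] at hpq
    ext i
    · by_cases hi : i < n
      · exact hpq.1 ⟨i, hi⟩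
      · rw [(hp.const i (by omega)).1, (hq.const i (by omega)).1]
    · by_cases hi : i < n
      · exact hpq.2 ⟨i, hi⟩
      · rw [(hp.const i (by omega)).2, (hq.const i (by omega)).2]

/-- The last edge of a lollipop may be replaced by any edge at the last vertex that is not the
last edge of the path. -/
lemma IsLollipop.update (hn : 2 ≤ n) (h : G.IsLollipop n x a p) {f : β}
    (hf : G.Inc f (p.1 (n - 1))) (hne : f ≠ p.2 (n - 2)) :
    G.IsLollipop n x a (p.1, Function.update p.2 (n - 1) f) := by
  have hu : ∀ i, i ≠ n - 1 → Function.update p.2 (n - 1) f i = p.2 i := fun i hi =>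
    Function.update_of_ne hi _ _
  have hnew : ∀ i < n, i ≠ n - 1 → p.2 i ≠ f := by
    rintro i hi hi' rfl
    have hl := h.link i (by omega)
    rcases hf.eq_or_eq_of_isLink hl with h1 | h1
    · have := h.inj_vertex (show n - 1 < n by omega) hi h1; omega
    · have := h.inj_vertex (show n - 1 < n by omega) (show i + 1 < n by omega) h1
      exact hne (by rw [show n - 2 = i by omega])
  refine ⟨h.inj_vertex, h.image_vertex, ?_, ?_, ?_, h.vertex_zero, ?_, ?_⟩
  · intro i hi k hk hik
    simp only at hik
    by_cases h1 : i = n - 1 <;> by_cases h2 : k = n - 1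
    · omega
    · rw [hu k h2, h1, Function.update_self] at hik
      exact (hnew k hk h2 hik.symm).elim
    · rw [hu i h1, h2, Function.update_self] at hik
      exact (hnew i hi h1 hik).elim
    · rw [hu k h2, hu i h1] at hik
      exact h.inj_edge hi hk hik
  · intro i hi
    simp only
    rw [hu i (by omega)]
    exact h.link i hi
  · simpa using hf
  · simp only
    rw [hu 0 (by omega), h.edge_zero]
  · intro i hi
    simp only
    rw [hu i (by omega)]
    exact h.const i hi

lemma IsLollipop.last_ne (hn : 2 ≤ n) (h : G.IsLollipop n x a p) : p.2 (n - 1) ≠ p.2 (n - 2) := by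
  intro heq
  have := h.inj_edge (show n - 1 < n by omega) (show n - 2 < n by omega) heq
  omega

-- Lollipops are grouped by their underlying hamiltonian path; each group has `deg y - 1` members,
-- where `y` is the last vertex.
open Classical in
lemma even_card_lollipops (hG : G.IsMultigraph) (hodd : ∀ x ∈ G.vertexSet, Odd (G.degree x))
    (hn : 2 ≤ n) (x : α) (a : β) :
    Even (finite_setOf_isLollipop hG n x a).toFinset.card := by
  set S := (finite_setOf_isLollipop hG n x a).toFinset
  have hS : ∀ p, p ∈ S ↔ G.IsLollipop n x a p := fun p => by simp [S]
  -- Writing the dummy value `a` at position `n - 1 ≥ 1` forgets the extra edge and keeps the path.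
  rw [Finset.card_eq_sum_card_image
    (fun p : (ℕ → α) × (ℕ → β) => (p.1, Function.update p.2 (n - 1) a)) S]
  refine Finset.even_sum _ fun q hq => ?_
  obtain ⟨p, hp, rfl⟩ := Finset.mem_image.1 hq
  rw [hS] at hp
  have hlast : p.1 (n - 1) ∈ G.vertexSet := hp.inc_last.vertex_mem
  have hfin : (G.incidenceSet (p.1 (n - 1)) \ {p.2 (n - 2)}).Finite :=
    (hG.finite_edgeSet.subset (G.incidenceSet_subset_edgeSet _)).sdiff
  have hmem : p.2 (n - 2) ∈ G.incidenceSet (p.1 (n - 1)) := by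
    have := (hp.link (n - 2) (by omega)).inc_right
    rwa [show n - 2 + 1 = n - 1 by omega] at this
  have hcard : hfin.toFinset.card + 1 = G.degree (p.1 (n - 1)) := by
    rw [← Set.ncard_eq_toFinset_card _ hfin, Graph.degree]
    exact Set.ncard_sdiff_singleton_add_one hmem
      (hG.finite_edgeSet.subset (G.incidenceSet_subset_edgeSet _))
  have heq : S.filter (fun q => (q.1, Function.update q.2 (n - 1) a) =
      (p.1, Function.update p.2 (n - 1) a)) =
      hfin.toFinset.image (fun f => (p.1, Function.update p.2 (n - 1) f)) := by
    ext q
    simp only [Finset.mem_filter, hS, Finset.mem_image, Set.Finite.mem_toFinset, Set.mem_sdiff,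
      mem_incidenceSet, Set.mem_singleton_iff, Prod.mk.injEq]
    constructor
    · rintro ⟨hq, h1, h2⟩
      have h3 : ∀ i, i ≠ n - 1 → q.2 i = p.2 i := fun i hi => by
        have := congrFun h2 i
        rwa [Function.update_of_ne hi, Function.update_of_ne hi] at this
      refine ⟨q.2 (n - 1), ⟨h1 ▸ hq.inc_last, ?_⟩, ?_⟩
      · rw [← h3 _ (by omega)]; exact hq.last_ne hn
      · refine Prod.ext h1.symm (funext fun i => ?_)
        by_cases hi : i = n - 1
        · subst hi; simp
        · simp only [Function.update_of_ne hi, h3 i hi]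
    · rintro ⟨f, ⟨h1, h2⟩, rfl⟩
      exact ⟨hp.update hn h1 h2, rfl, by simp⟩
  rw [heq, Finset.card_image_of_injective]
  · have := hodd _ hlast
    rw [← hcard] at this
    exact (Nat.odd_add_one.1 this) |> Nat.not_odd_iff_even.1
  · intro f g hfg
    have := congrFun (congrArg Prod.snd hfg) (n - 1)
    simpa using this

open Classical in
/-- In a multigraph with odd degrees only, the number of hamiltonian cycles through an edge,
counted as closed lollipops, is even. -/
lemma even_card_closed_lollipops (hG : G.IsMultigraph)
    (hodd : ∀ x ∈ G.vertexSet, Odd (G.degree x)) (hn : 2 ≤ n) (x : α) (a : β) :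
    Even ((finite_setOf_isLollipop hG n x a).toFinset.filter
      (fun p => G.lollipopEnd n p = 0)).card := by
  have hS := even_card_lollipops hG hodd hn x a
  set S := (finite_setOf_isLollipop hG n x a).toFinset
  have hmem : ∀ p, p ∈ S ↔ G.IsLollipop n x a p := fun p => by simp [S]
  have hB : Even (S.filter (fun p => ¬ G.lollipopEnd n p = 0)).card := by
    have : ∑ _p ∈ S.filter (fun p => ¬ G.lollipopEnd n p = 0), (1 : ZMod 2) = 0 := by
      refine Finset.sum_involution (fun p _ => G.lollipopSwap n p) ?_ ?_ ?_ ?_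
      · intro p _; decide
      · intro p hp _
        simp only [Finset.mem_filter, hmem] at hp
        exact hp.1.swap_ne hG.loopless
      · intro p hp
        simp only [Finset.mem_filter, hmem] at hp ⊢
        exact ⟨hp.1.swap hG.loopless hp.2, by rw [hp.1.end_swap hG.loopless hp.2]; exact hp.2⟩
      · intro p hp
        simp only [Finset.mem_filter, hmem] at hp
        exact hp.1.swap_swap hG.loopless hp.2
    rw [Finset.sum_const, nsmul_one] at this
    exact (ZMod.natCast_eq_zero_iff_even).1 this
  have := S.card_filter_add_card_filter_not (fun p => G.lollipopEnd n p = 0)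
  rw [← this] at hS
  exact (Nat.even_add.1 hS).2 hB

/-- A multigraph with odd degrees only is not uniquely hamiltonian. -/
theorem IsMultigraph.not_isUniquelyHamiltonian (hG : G.IsMultigraph)
    (hodd : ∀ x ∈ G.vertexSet, Odd (G.degree x)) : ¬ G.IsUniquelyHamiltonian := by
  classical
  rintro ⟨C, hC, huniq⟩
  obtain ⟨n, v, e, hs, hCe⟩ := hC.exists_isCycleSeq
  have hn := hs.two_le
  have heven := even_card_closed_lollipops hG hodd hn (v 0) (e 0)
  set S := (finite_setOf_isLollipop hG n (v 0) (e 0)).toFinset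
  have hmem : ∀ p, p ∈ S ↔ G.IsLollipop n (v 0) (e 0) p := fun p => by simp [S]
  set p₀ : (ℕ → α) × (ℕ → β) :=
    (fun i => if i < n then v i else v 0, fun i => if i < n then e i else e 0)
  have hp1 : ∀ i < n, p₀.1 i = v i := fun i hi => if_pos hi
  have hp2 : ∀ i < n, p₀.2 i = e i := fun i hi => if_pos hi
  have hp₀ : G.IsLollipop n (v 0) (e 0) p₀ := by
    refine ⟨?_, ?_, ?_, ?_, ?_, hp1 0 (by omega), hp2 0 (by omega), fun i hi => ?_⟩
    · exact hs.inj_vertex.congr fun i hi => (hp1 i hi).symm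
    · rw [← hs.image_vertex]; exact image_congr hp1
    · exact hs.inj_edge.congr fun i hi => (hp2 i hi).symm
    · intro i hi
      rw [hp1 i (by omega), hp1 (i + 1) hi, hp2 i (by omega)]
      exact hs.link i hi
    · rw [hp1 _ (by omega), hp2 _ (by omega)]
      exact hs.link_last.inc_left
    · simp [p₀, Nat.not_lt.2 hi]
  have hclosed : ∀ p, G.IsLollipop n (v 0) (e 0) p → G.lollipopEnd n p = 0 → p.2 '' Iio n = C := by
    intro p hp h0
    have hl := hp.lollipopEnd_spec.2
    rw [h0] at hl
    exact huniq _ (IsCycleSeq.isHamiltonianCycle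
      ⟨hn, hp.inj_vertex, hp.image_vertex, hp.inj_edge, hp.link, hl⟩)
  have hone : S.filter (fun p => G.lollipopEnd n p = 0) = {p₀} := by
    ext p
    simp only [Finset.mem_filter, hmem, Finset.mem_singleton]
    constructor
    · rintro ⟨hp, h0⟩
      have hpC := hclosed p hp h0
      -- At `v (i + 1)` the set `C` has only the edges `e i` and `e (i + 1)`. A closed lollipop with
      -- edge set `C` has just used `e i`, so it must continue with `e (i + 1)`.
      have key : ∀ i < n, p.1 i = v i ∧ p.2 i = e i := by
        intro i
        induction i with
        | zero => exact fun _ => ⟨hp.vertex_zero, hp.edge_zero⟩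
        | succ i ih =>
          intro hi
          obtain ⟨h1, h2⟩ := ih (by omega)
          have hv : p.1 (i + 1) = v (i + 1) := by
            have ha := hp.link i hi
            have hb := hs.link i hi
            rw [h1, h2] at ha
            exact ha.right_unique hb
          refine ⟨hv, ?_⟩
          have hin : p.2 (i + 1) ∈ e '' Iio n := by
            rw [hCe, ← hpC]; exact ⟨i + 1, hi, rfl⟩
          obtain ⟨k, hk, hek⟩ := hin
          have hk' : k < n := hk
          have hinc : G.Inc (e k) (v (i + 1)) := by
            rw [hek, ← hv]
            by_cases hi2 : i + 1 + 1 < n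
            · exact (hp.link _ hi2).inc_left
            · have : i + 1 = n - 1 := by omega
              rw [this]; exact hp.inc_last
          have hki : k ≠ i := by
            rintro rfl
            rw [← h2] at hek
            have := hp.inj_edge (show k < n by omega) hi hek
            omega
          have : k = i + 1 := by
            by_cases hk2 : k + 1 < n
            · rcases hinc.eq_or_eq_of_isLink (hs.link k hk2) with h3 | h3
              · exact (hs.inj_vertex hi hk h3).symm
              · have := hs.inj_vertex hi hk2 h3; omega
            · have hkn : k = n - 1 := by omega
              subst hkn
              rcases hinc.eq_or_eq_of_isLink hs.link_last with h3 | h3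
              · exact (hs.inj_vertex hi hk h3).symm
              · have := hs.inj_vertex hi (show 0 < n by omega) h3; omega
          rw [← hek, this]
      ext i
      · by_cases hi : i < n
        · rw [hp1 i hi, (key i hi).1]
        · rw [(hp.const i (by omega)).1, (hp₀.const i (by omega)).1]
      · by_cases hi : i < n
        · rw [hp2 i hi, (key i hi).2]
        · rw [(hp.const i (by omega)).2, (hp₀.const i (by omega)).2]
    · rintro rfl
      refine ⟨hp₀, hp₀.lollipopEnd_eq (by omega) ?_⟩
      rw [hp1 _ (by omega), hp2 _ (by omega), hp1 _ (by omega)]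
      exact hs.link_last
  rw [hone] at heven
  simp at heven

end Graph

/-! ### Replacing a root by a triangle: spanning cycles -/

open Relation

/-- `w x y` is the number of edges between `x` and `y` in a loopless multigraph with the vertices
`0, …, n - 1`. -/
structure IsMultiplicity (n : ℕ) (w : ℕ → ℕ → ℕ) : Prop where
  symm : ∀ x y, w x y = w y x
  self : ∀ x, w x x = 0
  lt : ∀ {x y}, w x y ≠ 0 → x < n

/-- A spanning cycle, as a connected `2`-regular adjacency relation. -/
structure IsSpanningCycle (n : ℕ) (w : ℕ → ℕ → ℕ) (E : ℕ → ℕ → Prop) : Prop where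
  symm : ∀ {x y}, E x y → E y x
  ne_zero : ∀ {x y}, E x y → w x y ≠ 0
  two : ∀ x < n, ∃ y z, y ≠ z ∧ ∀ u, E x u ↔ u = y ∨ u = z
  conn : ∀ x < n, ∀ y < n, ReflTransGen E x y

/-- A multigraph with exactly one spanning cycle, all of whose edges are simple, together with
a vertex `v` which has simple edges to its neighbours `a` and `b` on the cycle and which has at most
one further neighbour `c`. -/
structure IsRooted (n : ℕ) (w : ℕ → ℕ → ℕ) (v a b c : ℕ) : Prop extends IsMultiplicity n w where
  nbr : ∀ {x}, w v x ≠ 0 → x = a ∨ x = b ∨ x = c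
  left : w v a = 1
  right : w v b = 1
  ne_ab : a ≠ b
  ne_ca : c ≠ a
  ne_cb : c ≠ b
  c_lt : c < n
  cycle : ∃ m : List ℕ, (v :: (b :: m ++ [a])).Nodup ∧ (∀ x, x ∈ v :: (b :: m ++ [a]) ↔ x < n) ∧
    (b :: m ++ [a]).IsChain (fun x y => w x y = 1)
  unique : ∀ {E E' : ℕ → ℕ → Prop}, IsSpanningCycle n w E → IsSpanningCycle n w E' →
    ∀ {x y}, E x y → E' x y

/-- Subdivide the edges `va` and `vb` by new vertices `n` and `n + 1` and join these by `k` edges. -/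
def expand (n v a b k : ℕ) (w : ℕ → ℕ → ℕ) (x y : ℕ) : ℕ :=
  if s(x, y) = s(v, a) ∨ s(x, y) = s(v, b) then 0
  else if s(x, y) = s(n, a) ∨ s(x, y) = s(n, v) ∨ s(x, y) = s(n + 1, b) ∨ s(x, y) = s(n + 1, v) then 1
  else if s(x, y) = s(n, n + 1) then k
  else w x y

lemma ReflTransGen.mem_of_closed {α : Type*} {r : α → α → Prop} {P : α → Prop}
    (hP : ∀ x y, P x → r x y → P y) {x y : α} (h : ReflTransGen r x y) (hx : P x) : P y := by
  induction h with
  | refl => exact hx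
  | tail _ h ih => exact hP _ _ ih h

lemma two_of_three {P : ℕ → Prop} (h : ∃ y z, y ≠ z ∧ ∀ u, P u ↔ u = y ∨ u = z) {p q r : ℕ}
    (hP : ∀ u, P u → u = p ∨ u = q ∨ u = r) (hpq : p ≠ q) (hpr : p ≠ r) (hqr : q ≠ r) :
    (P p ∧ P q ∧ ¬ P r) ∨ (P p ∧ ¬ P q ∧ P r) ∨ (¬ P p ∧ P q ∧ P r) := by
  obtain ⟨y, z, hyz, h⟩ := h
  have h1 := hP y ((h y).2 (Or.inl rfl))
  have h2 := hP z ((h z).2 (Or.inr rfl))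
  simp only [h]
  omega

namespace IsRooted

variable {n : ℕ} {w : ℕ → ℕ → ℕ} {v a b c k : ℕ} {x y : ℕ}

section basic
variable (h : IsRooted n w v a b c)
include h

lemma lt' (hxy : w x y ≠ 0) : y < n := h.lt (h.symm x y ▸ hxy)
lemma v_lt : v < n := h.lt (by rw [h.left]; decide : w v a ≠ 0)
lemma a_lt : a < n := h.lt' (by rw [h.left]; decide : w v a ≠ 0)
lemma b_lt : b < n := h.lt' (by rw [h.right]; decide : w v b ≠ 0)
lemma a_ne : a ≠ v := by rintro rfl; have := h.left; rw [h.self] at this; omega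
lemma b_ne : b ≠ v := by rintro rfl; have := h.right; rw [h.self] at this; omega

lemma eq_zero (hx : n ≤ x) : w x y = 0 := by
  by_contra h0; have := h.lt h0; omega

lemma expand_symm : expand n v a b k w x y = expand n v a b k w y x := by
  unfold expand; rw [Sym2.eq_swap, h.symm]

lemma expand_left : expand n v a b k w n y =
    if y = a ∨ y = v then 1 else if y = n + 1 then k else 0 := by
  have := h.v_lt; have := h.a_lt; have := h.b_lt
  have := h.eq_zero (y := y) le_rfl
  simp only [expand, Sym2.eq_iff]
  grind


lemma expand_right : expand n v a b k w (n + 1) y =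
    if y = b ∨ y = v then 1 else if y = n then k else 0 := by
  have := h.v_lt; have := h.a_lt; have := h.b_lt
  have := h.eq_zero (y := y) (Nat.le_succ n)
  simp only [expand, Sym2.eq_iff]
  grind

lemma expand_root : expand n v a b k w v y =
    if y = n ∨ y = n + 1 then 1 else if y = a ∨ y = b then 0 else w v y := by
  have := h.v_lt; have := h.a_lt; have := h.b_lt; have := h.a_ne; have := h.b_ne
  simp only [expand, Sym2.eq_iff]
  grind

lemma expand_old (hx : x < n) (hy : y < n) (hxv : x ≠ v) (hyv : y ≠ v) :
    expand n v a b k w x y = w x y := by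
  have := h.v_lt; have := h.a_lt; have := h.b_lt
  simp only [expand, Sym2.eq_iff]
  grind

lemma isMultiplicity_expand : IsMultiplicity (n + 2) (expand n v a b k w) where
  symm _ _ := h.expand_symm
  self x := by
    have := h.v_lt; have := h.a_lt; have := h.b_lt; have := h.a_ne; have := h.b_ne
    have := h.self x
    simp only [expand, Sym2.eq_iff]
    grind
  lt {x y} hxy := by
    have := h.v_lt; have := h.a_lt; have := h.b_lt
    have := @h.lt x y
    simp only [expand, Sym2.eq_iff] at hxy
    grind

end basic

/-- The relation on the old graph induced by a relation on the expanded graph, where the new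
vertices are identified with the root. -/
def contract (n v : ℕ) (E : ℕ → ℕ → Prop) (x y : ℕ) : Prop :=
  x ≠ y ∧ ∃ x' y', E x' y' ∧ (if x' < n then x' else v) = x ∧ (if y' < n then y' else v) = y

section contract
variable (h : IsRooted n w v a b c) {E : ℕ → ℕ → Prop}
  (hE : IsSpanningCycle (n + 2) (expand n v a b k w) E)

include hE in
lemma contract_symm (hxy : contract n v E x y) : contract n v E y x := by
  obtain ⟨hne, x', y', hxy, h1, h2⟩ := hxy
  exact ⟨hne.symm, y', x', hE.symm hxy, h2, h1⟩

include h hE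

lemma of_left (hu : E n x) : x = a ∨ x = v ∨ x = n + 1 := by
  have := hE.ne_zero hu
  rw [h.expand_left] at this
  split_ifs at this <;> omega

lemma of_right (hu : E (n + 1) x) : x = b ∨ x = v ∨ x = n := by
  have := hE.ne_zero hu
  rw [h.expand_right] at this
  split_ifs at this <;> omega

lemma of_root (hu : E v x) : x = n ∨ x = n + 1 ∨ x = c := by
  have := hE.ne_zero hu
  rw [h.expand_root] at this
  split_ifs at this with h1 h2
  · omega
  · omega
  · rcases h.nbr this with h3 | h3 | h3 <;> omega

lemma not_self : ¬ E x x := fun hx => hE.ne_zero hx (h.isMultiplicity_expand.self x)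

/-- A spanning cycle of the expanded graph enters the three vertices that replace the root exactly
twice, and its edges between them are determined by the entries. -/
lemma cases_of_isSpanningCycle :
    (E n a ∧ E (n + 1) b ∧ ¬ E v c ∧ E n v ∧ E (n + 1) v ∧ ¬ E n (n + 1)) ∨
    (E n a ∧ ¬ E (n + 1) b ∧ E v c ∧ ¬ E n v ∧ E (n + 1) v ∧ E n (n + 1)) ∨
    (¬ E n a ∧ E (n + 1) b ∧ E v c ∧ E n v ∧ ¬ E (n + 1) v ∧ E n (n + 1)) := by
  have hv := h.v_lt; have ha := h.a_lt; have hb := h.b_lt; have := h.c_lt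
  have h1 := two_of_three (hE.two n (by omega)) (fun u => h.of_left hE) h.a_ne (by omega) (by omega)
  have h2 := two_of_three (hE.two (n + 1) (by omega)) (fun u => h.of_right hE) h.b_ne (by omega)
    (by omega)
  have h3 := two_of_three (hE.two v (by omega)) (fun u => h.of_root hE) (by omega) (by omega)
    (by omega)
  have s1 : E v n ↔ E n v := ⟨hE.symm, hE.symm⟩
  have s2 : E v (n + 1) ↔ E (n + 1) v := ⟨hE.symm, hE.symm⟩
  have s3 : E (n + 1) n ↔ E n (n + 1) := ⟨hE.symm, hE.symm⟩
  -- Without exits the triangle would be closed under `E`. As each of its vertices has two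
  -- neighbours, the number of exits used is even, hence two.
  have h4 : ¬ (¬ E n a ∧ ¬ E (n + 1) b ∧ ¬ E v c) := by
    rintro ⟨h5, h6, h7⟩
    have := ReflTransGen.mem_of_closed (P := fun x => x = v ∨ x = n ∨ x = n + 1) (r := E) ?_
      (hE.conn v (by omega) a (by omega)) (Or.inl rfl)
    · have := h.a_ne; omega
    · rintro x y (rfl | rfl | rfl) hxy
      · rcases h.of_root hE hxy with rfl | rfl | rfl <;> grind
      · rcases h.of_left hE hxy with rfl | rfl | rfl <;> grind
      · rcases h.of_right hE hxy with rfl | rfl | rfl <;> grind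
  grind

lemma contract_root : contract n v E v x ↔ (x = a ∧ E n a) ∨ (x = b ∧ E (n + 1) b) ∨
    (x = c ∧ E v c) := by
  have hv := h.v_lt; have ha := h.a_lt; have hb := h.b_lt; have := h.c_lt
  have hav := h.a_ne; have hbv := h.b_ne
  constructor
  · rintro ⟨hne, x', y', hxy, h1, h2⟩
    have hx' : x' = v ∨ x' = n ∨ x' = n + 1 := by
      have := (h.isMultiplicity_expand (k := k)).lt (hE.ne_zero hxy)
      split_ifs at h1 <;> omega
    rcases hx' with rfl | rfl | rfl
    · rcases h.of_root hE hxy with rfl | rfl | rfl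
      · simp at h2; omega
      · simp at h2; omega
      · rw [if_pos h.c_lt] at h2; subst h2; tauto
    · rcases h.of_left hE hxy with rfl | rfl | rfl
      · rw [if_pos ha] at h2; subst h2; tauto
      · rw [if_pos hv] at h2; omega
      · simp at h2; omega
    · rcases h.of_right hE hxy with rfl | rfl | rfl
      · rw [if_pos hb] at h2; subst h2; tauto
      · rw [if_pos hv] at h2; omega
      · simp at h2; omega
  · rintro (⟨rfl, h1⟩ | ⟨rfl, h1⟩ | ⟨rfl, h1⟩)
    · exact ⟨hav.symm, n, x, h1, by simp, by simp [ha]⟩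
    · exact ⟨hbv.symm, n + 1, x, h1, by simp, by simp [hb]⟩
    · refine ⟨?_, v, x, h1, by simp [hv], by simp [h.c_lt]⟩
      rintro rfl; exact h.not_self hE h1

lemma contract_of_ne (hx : x < n) (hxv : x ≠ v) : contract n v E x y ↔
    ∃ y', E x y' ∧ (if y' < n then y' else v) = y := by
  constructor
  · rintro ⟨hne, x', y', hxy, h1, h2⟩
    have : x' = x := by split_ifs at h1 <;> omega
    exact ⟨y', this ▸ hxy, h2⟩
  · rintro ⟨y', hxy, h2⟩
    refine ⟨?_, x, y', hxy, by simp [hx], h2⟩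
    rintro rfl
    have : y' = x := by split_ifs at h2 <;> omega
    exact h.not_self hE (this ▸ hxy)

lemma contract_old (hx : x < n) (hy : y < n) (hxv : x ≠ v) (hyv : y ≠ v) :
    contract n v E x y ↔ E x y := by
  rw [h.contract_of_ne hE hx hxv]
  constructor
  · rintro ⟨y', hxy, h2⟩
    have : y' = y := by split_ifs at h2 <;> omega
    exact this ▸ hxy
  · exact fun hxy => ⟨y, hxy, if_pos hy⟩

/-- Two exits are used, so the root gets two neighbours. Other vertices keep theirs because `a`,
`b`, `c` are distinct, so that no outside vertex sees two of the triangle's vertices. -/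
lemma isSpanningCycle_contract : IsSpanningCycle n w (contract n v E) where
  symm hxy := contract_symm hE hxy
  ne_zero {x y} hxy := by
    have key : ∀ {y}, contract n v E v y → w v y ≠ 0 := by
      intro y hy
      rw [h.contract_root hE] at hy
      rcases hy with ⟨rfl, -⟩ | ⟨rfl, -⟩ | ⟨rfl, hy⟩
      · rw [h.left]; decide
      · rw [h.right]; decide
      · have := hE.ne_zero hy
        rw [h.expand_root] at this
        have := h.c_lt
        grind
    by_cases hxv : x = v
    · subst hxv; exact key hxy
    by_cases hyv : y = v
    · subst hyv; rw [h.symm]; exact key (contract_symm hE hxy)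
    have hv := h.v_lt
    have hlt : ∀ {x y}, contract n v E x y → x < n := by
      rintro x y ⟨-, x', y', -, h1, -⟩
      split_ifs at h1 <;> omega
    have hx := hlt hxy
    have hy := hlt (contract_symm hE hxy)
    rw [h.contract_old hE hx hy hxv hyv] at hxy
    have := hE.ne_zero hxy
    rwa [h.expand_old hx hy hxv hyv] at this
  two x hx := by
    have hv := h.v_lt; have ha := h.a_lt; have hb := h.b_lt; have := h.c_lt
    have hca := h.ne_ca; have hcb := h.ne_cb; have hab := h.ne_ab
    by_cases hxv : x = v
    · subst hxv
      simp only [h.contract_root hE]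
      rcases h.cases_of_isSpanningCycle hE with h1 | h1 | h1
      · exact ⟨a, b, hab, fun u => by tauto⟩
      · exact ⟨a, c, hca.symm, fun u => by tauto⟩
      · exact ⟨b, c, hcb.symm, fun u => by tauto⟩
    · obtain ⟨y, z, hyz, htwo⟩ := hE.two x (by omega)
      refine ⟨if y < n then y else v, if z < n then z else v, ?_, fun u => ?_⟩
      · have main : ∀ {y}, E x y → y < n + 2 ∧ (y = n → x = a) ∧ (y = n + 1 → x = b) ∧
            (y = v → x = c) := by
          intro y hy
          refine ⟨(h.isMultiplicity_expand (k := k)).lt (hE.ne_zero (hE.symm hy)), ?_, ?_, ?_⟩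
          · rintro rfl; have := h.of_left hE (hE.symm hy); omega
          · rintro rfl; have := h.of_right hE (hE.symm hy); omega
          · rintro rfl; have := h.of_root hE (hE.symm hy); omega
        have h1 := main ((htwo y).2 (Or.inl rfl))
        have h2 := main ((htwo z).2 (Or.inr rfl))
        split_ifs <;> omega
      · rw [h.contract_of_ne hE hx hxv]
        simp only [htwo]
        constructor
        · rintro ⟨y', rfl | rfl, rfl⟩ <;> simp
        · rintro (rfl | rfl)
          · exact ⟨y, by simp, rfl⟩
          · exact ⟨z, by simp, rfl⟩
  conn x hx y hy := by
    have := (hE.conn x (by omega) y (by omega)).lift' (p := contract n v E)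
      (fun x => if x < n then x else v) ?_
    · simpa [Function.onFun, hx, hy] using this
    · intro x' y' hxy
      by_cases heq : (if x' < n then x' else v) = (if y' < n then y' else v)
      · simp only [Function.onFun, heq]; exact ReflTransGen.refl
      · exact ReflTransGen.single ⟨heq, x', y', hxy, rfl, rfl⟩

end contract

variable (h : IsRooted n w v a b c)
include h

/-- Both cycles have the same contraction, hence the same exits and the same route through the
triangle; away from the triangle contraction changes nothing. -/
lemma unique_expand {E E' : ℕ → ℕ → Prop}
    (hE : IsSpanningCycle (n + 2) (expand n v a b k w) E)
    (hE' : IsSpanningCycle (n + 2) (expand n v a b k w) E') (hxy : E x y) : E' x y := by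
  have heq : ∀ x y, contract n v E x y ↔ contract n v E' x y := fun x y =>
    ⟨h.unique (h.isSpanningCycle_contract hE) (h.isSpanningCycle_contract hE'),
      h.unique (h.isSpanningCycle_contract hE') (h.isSpanningCycle_contract hE)⟩
  have hv := h.v_lt; have ha := h.a_lt; have hb := h.b_lt; have := h.c_lt
  have hca := h.ne_ca; have hcb := h.ne_cb; have hab := h.ne_ab
  -- Exactly two of three exits are used, so the exits to `a` and `b` decide about the third.
  have ea : E n a ↔ E' n a := by
    have := heq v a
    rw [h.contract_root hE, h.contract_root hE'] at this
    simpa [hab, hca.symm] using this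
  have eb : E (n + 1) b ↔ E' (n + 1) b := by
    have := heq v b
    rw [h.contract_root hE, h.contract_root hE'] at this
    simpa [hab.symm, hcb.symm] using this
  have c1 := h.cases_of_isSpanningCycle hE
  have c2 := h.cases_of_isSpanningCycle hE'
  have l1 : ∀ {y}, E n y → E' n y := by
    intro y hy
    rcases h.of_left hE hy with rfl | rfl | rfl <;> grind
  have l2 : ∀ {y}, E (n + 1) y → E' (n + 1) y := by
    intro y hy
    have s3 : E (n + 1) n ↔ E n (n + 1) := ⟨hE.symm, hE.symm⟩
    have s4 : E' (n + 1) n ↔ E' n (n + 1) := ⟨hE'.symm, hE'.symm⟩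
    rcases h.of_right hE hy with rfl | rfl | rfl <;> grind
  have l3 : ∀ {y}, E v y → E' v y := by
    intro y hy
    rcases h.of_root hE hy with rfl | rfl | rfl
    · exact hE'.symm (l1 (hE.symm hy))
    · exact hE'.symm (l2 (hE.symm hy))
    · tauto
  have cases : ∀ {x y}, E x y → x = n ∨ x = n + 1 ∨ x = v ∨ (x < n ∧ x ≠ v) := by
    intro x y hx
    have := (h.isMultiplicity_expand (k := k)).lt (hE.ne_zero hx)
    omega
  rcases cases hxy with rfl | rfl | rfl | ⟨hx, hxv⟩
  · exact l1 hxy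
  · exact l2 hxy
  · exact l3 hxy
  rcases cases (hE.symm hxy) with rfl | rfl | rfl | ⟨hy, hyv⟩
  · exact hE'.symm (l1 (hE.symm hxy))
  · exact hE'.symm (l2 (hE.symm hxy))
  · exact hE'.symm (l3 (hE.symm hxy))
  rw [← h.contract_old hE hx hy hxv hyv, heq, h.contract_old hE' hx hy hxv hyv] at hxy
  exact hxy

/-- The expanded graph is again rooted at `v`. -/
theorem isRooted_expand (k : ℕ) :
    IsRooted (n + 2) (expand n v a b k w) v n (n + 1) c := by
  have hv := h.v_lt; have ha := h.a_lt; have hb := h.b_lt; have hc := h.c_lt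
  refine ⟨h.isMultiplicity_expand, ?_, ?_, ?_, by omega, by omega, by omega, by omega, ?_,
    fun hE hE' _ _ => h.unique_expand hE hE'⟩
  · intro x hx
    rw [h.expand_root] at hx
    split_ifs at hx with h1 h2
    · omega
    · omega
    · rcases h.nbr hx with h3 | h3 | h3 <;> omega
  · simp [h.expand_root]
  · simp [h.expand_root]
  · obtain ⟨m, hnd, hmem, hch⟩ := h.cycle
    -- The new cycle runs `v, n + 1, b, …, a, n` and so avoids the `k` parallel edges.
    refine ⟨b :: m ++ [a], ?_, ?_, ?_⟩
    · have h1 : n ∉ v :: (b :: m ++ [a]) := by rw [hmem]; omega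
      have h2 : n + 1 ∉ v :: (b :: m ++ [a]) := by rw [hmem]; omega
      generalize (b :: m ++ [a]) = l at *
      simp only [List.cons_append, List.nodup_cons, List.mem_cons, List.mem_append, not_or,
        List.nodup_append, List.not_mem_nil, not_false_eq_true] at *
      simp
      grind
    · intro x
      have := hmem x
      have hx : x ∈ v :: (n + 1) :: (b :: m ++ [a]) ++ [n] ↔
          x ∈ v :: (b :: m ++ [a]) ∨ x = n ∨ x = n + 1 := by
        simp only [List.cons_append, List.mem_cons, List.mem_append, List.not_mem_nil, or_false]
        tauto
      refine hx.trans ?_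
      rw [this]
      omega
    · have hnotin : v ∉ (b :: m ++ [a]) := (List.nodup_cons.1 hnd).1
      have hch' : (b :: m ++ [a]).IsChain (fun x y => expand n v a b k w x y = 1) := by
        refine List.IsChain.imp_of_mem_imp ?_ hch
        intro x y hx hy hxy
        have h1 := (hmem x).1 (List.mem_cons_of_mem _ hx)
        have h2 := (hmem y).1 (List.mem_cons_of_mem _ hy)
        rw [h.expand_old h1 h2 (by rintro rfl; exact hnotin hx) (by rintro rfl; exact hnotin hy)]
        exact hxy
      rw [List.cons_append, List.isChain_cons, List.isChain_append]
      refine ⟨?_, hch', by simp, ?_⟩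
      · simp [h.expand_right]
      · have := h.isMultiplicity_expand (k := k) |>.symm
        simp only [List.getLast?_append, List.getLast?_singleton, Option.some_or, List.head?_cons,
          Option.mem_def, Option.some.injEq]
        rintro x rfl y rfl
        simp [this _ n, h.expand_left]

end IsRooted

/-! ### Degrees and 3-connectedness under expansion -/

/-- The degree of `x` in the multigraph with multiplicities `w` on `0, …, n - 1`. -/
def multDegree (n : ℕ) (w : ℕ → ℕ → ℕ) (x : ℕ) : ℕ := ∑ y ∈ Finset.range n, w x y

/-- Adjacency after the deletion of `p` and `q`. -/
def AdjAvoiding (w : ℕ → ℕ → ℕ) (p q x y : ℕ) : Prop :=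
  w x y ≠ 0 ∧ (x ≠ p ∧ x ≠ q) ∧ (y ≠ p ∧ y ≠ q)

/-- The deletion of at most two vertices leaves a connected graph. -/
def IsThreeConnected (n : ℕ) (w : ℕ → ℕ → ℕ) : Prop :=
  ∀ p q x y, x < n → y < n → x ≠ p → x ≠ q → y ≠ p → y ≠ q → ReflTransGen (AdjAvoiding w p q) x y

lemma AdjAvoiding.symm {n : ℕ} {w : ℕ → ℕ → ℕ} (hw : IsMultiplicity n w) {p q x y : ℕ}
    (h : AdjAvoiding w p q x y) : AdjAvoiding w p q y x :=
  ⟨hw.symm x y ▸ h.1, h.2.2, h.2.1⟩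

lemma reflTransGen_adjAvoiding_symm {n : ℕ} {w : ℕ → ℕ → ℕ} (hw : IsMultiplicity n w)
    {p q x y : ℕ} (h : ReflTransGen (AdjAvoiding w p q) x y) :
    ReflTransGen (AdjAvoiding w p q) y x := by
  induction h with
  | refl => exact .refl
  | tail _ h ih => exact .head (h.symm hw) ih

lemma AdjAvoiding.comm {w : ℕ → ℕ → ℕ} {p q : ℕ} : AdjAvoiding w p q = AdjAvoiding w q p := by
  ext x y; unfold AdjAvoiding; tauto

namespace IsRooted

variable {n : ℕ} {w : ℕ → ℕ → ℕ} {v a b c k : ℕ} (h : IsRooted n w v a b c)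
include h

lemma multDegree_expand_old {x : ℕ} (hx : x < n) :
    multDegree (n + 2) (expand n v a b k w) x = multDegree n w x := by
  have hv := h.v_lt; have ha := h.a_lt; have hb := h.b_lt
  have hav := h.a_ne; have hbv := h.b_ne; have hab := h.ne_ab
  -- The correction terms are the deleted edges `va` and `vb`; the new columns `n` and `n + 1`
  -- compensate for them.
  have key : ∀ y ∈ Finset.range n, w x y = expand n v a b k w x y +
      ((if y = a then (if x = v then 1 else 0) else 0) +
       (if y = b then (if x = v then 1 else 0) else 0) +
       (if y = v then (if x = a ∨ x = b then 1 else 0) else 0)) := by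
    intro y hy
    rw [Finset.mem_range] at hy
    have h1 := h.left; have h2 := h.right
    have h3 := h.symm v a; have h4 := h.symm v b
    simp only [expand, Sym2.eq_iff]
    grind
  have e1 : expand n v a b k w x n = if x = a ∨ x = v then 1 else 0 := by
    rw [h.expand_symm, h.expand_left]; grind
  have e2 : expand n v a b k w x (n + 1) = if x = b ∨ x = v then 1 else 0 := by
    rw [h.expand_symm, h.expand_right]; grind
  unfold multDegree
  rw [Finset.sum_congr rfl key]
  simp only [Finset.sum_range_succ, Finset.sum_add_distrib, Finset.sum_ite_eq', Finset.mem_range,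
    hv, ha, hb, if_true, e1, e2]
  grind

lemma multDegree_expand_left : multDegree (n + 2) (expand n v a b k w) n = k + 2 := by
  have hv := h.v_lt; have ha := h.a_lt; have hav := h.a_ne
  have key : ∀ y ∈ Finset.range n, expand n v a b k w n y =
      (if y = a then 1 else 0) + (if y = v then 1 else 0) := by
    intro y hy
    rw [Finset.mem_range] at hy
    rw [h.expand_left]
    grind
  unfold multDegree
  rw [Finset.sum_range_succ, Finset.sum_range_succ, Finset.sum_congr rfl key]
  simp only [Finset.sum_add_distrib, Finset.sum_ite_eq', Finset.mem_range, hv, ha, if_true,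
    h.expand_left]
  grind

lemma multDegree_expand_right : multDegree (n + 2) (expand n v a b k w) (n + 1) = k + 2 := by
  have hv := h.v_lt; have hb := h.b_lt; have hbv := h.b_ne
  have key : ∀ y ∈ Finset.range n, expand n v a b k w (n + 1) y =
      (if y = b then 1 else 0) + (if y = v then 1 else 0) := by
    intro y hy
    rw [Finset.mem_range] at hy
    rw [h.expand_right]
    grind
  unfold multDegree
  rw [Finset.sum_range_succ, Finset.sum_range_succ, Finset.sum_congr rfl key]
  simp only [Finset.sum_add_distrib, Finset.sum_ite_eq', Finset.mem_range, hv, hb, if_true,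
    h.expand_right]
  grind

lemma multDegree_image_expand :
    multDegree (n + 2) (expand n v a b k w) '' Set.Iio (n + 2) =
      insert (k + 2) (multDegree n w '' Set.Iio n) := by
  ext d
  simp only [Set.mem_image, Set.mem_Iio, Set.mem_insert_iff]
  constructor
  · rintro ⟨x, hx, rfl⟩
    by_cases hxn : x < n
    · exact Or.inr ⟨x, hxn, (h.multDegree_expand_old hxn).symm⟩
    · left
      obtain rfl | rfl : x = n ∨ x = n + 1 := by omega
      · exact h.multDegree_expand_left
      · exact h.multDegree_expand_right
  · rintro (rfl | ⟨x, hx, rfl⟩)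
    · exact ⟨n, by omega, h.multDegree_expand_left⟩
    · exact ⟨x, by omega, h.multDegree_expand_old hx⟩

/-- After the deletion of one of the three vertices that replace the root, and of at most one
further vertex, the expanded graph is connected. -/
lemma connected_expand_of_mem (h3 : IsThreeConnected n w) (hc : w v c ≠ 0) (hk : k ≠ 0)
    {p q x y : ℕ} (hp : p = v ∨ p = n ∨ p = n + 1)
    (hx : x < n + 2) (hy : y < n + 2) (hxp : x ≠ p) (hxq : x ≠ q) (hyp : y ≠ p) (hyq : y ≠ q) :
    ReflTransGen (AdjAvoiding (expand n v a b k w) p q) x y := by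
  have hv := h.v_lt; have ha := h.a_lt; have hb := h.b_lt; have hcn := h.c_lt
  have hav := h.a_ne; have hbv := h.b_ne; have hab := h.ne_ab
  have hca := h.ne_ca; have hcb := h.ne_cb
  have hcv : c ≠ v := by rintro rfl; exact hc (h.self _)
  have hw := h.isMultiplicity_expand (k := k)
  set w' := expand n v a b k w
  have hpo : ∀ u, u < n → u ≠ v → u ≠ p := by
    rintro u h1 h2 rfl; omega
  -- Outside the triangle, deleting `p` and `q` leaves what deleting `v` and `q` leaves in the old
  -- graph.
  have outer : ∀ x y, x < n → y < n → x ≠ v → y ≠ v → x ≠ q → y ≠ q →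
      ReflTransGen (AdjAvoiding w' p q) x y := by
    intro x y hx hy hxv hyv hxq hyq
    refine ReflTransGen.mono ?_ x y (h3 v q x y hx hy hxv hxq hyv hyq)
    rintro x y ⟨hxy, ⟨h1, h2⟩, h4, h5⟩
    have hx := h.lt hxy
    have hy := h.lt' hxy
    refine ⟨?_, ⟨hpo x hx h1, h2⟩, hpo y hy h4, h5⟩
    rw [show w' x y = w x y from h.expand_old hx hy h1 h4]
    exact hxy
  -- A triangle vertex `t` leaves through its own exit `u`; if `u = q`, it goes through the other
  -- remaining triangle vertex `t'`, whose exit is different.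
  have step : ∀ t t' u u', w' t t' ≠ 0 → w' t u ≠ 0 → w' t' u' ≠ 0 → u ≠ u' → u < n → u' < n →
      u ≠ v → u' ≠ v → t ≠ p → t ≠ q → t' ≠ p → (t' = v ∨ t' = n ∨ t' = n + 1) →
      ∃ z, z < n ∧ z ≠ v ∧ z ≠ q ∧ ReflTransGen (AdjAvoiding w' p q) t z := by
    intro t t' u u' htt htu htu' huu hu hu' huv huv' htp htq htp' ht'
    by_cases huq : u = q
    · subst huq
      have hu'q := huu.symm
      have htq' : t' ≠ u := by rintro rfl; omega
      exact ⟨u', hu', huv', hu'q, .head ⟨htt, ⟨htp, htq⟩, htp', htq'⟩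
        (.single ⟨htu', ⟨htp', htq'⟩, hpo u' hu' huv', hu'q⟩)⟩
    · exact ⟨u, hu, huv, huq, .single ⟨htu, ⟨htp, htq⟩, hpo u hu huv, huq⟩⟩
  have tri : w' n v ≠ 0 ∧ w' (n + 1) v ≠ 0 ∧ w' n (n + 1) ≠ 0 := by
    refine ⟨?_, ?_, ?_⟩
    · simp [w', h.expand_left]
    · simp [w', h.expand_right]
    · simp only [w', h.expand_left]; grind
  have ext : w' n a ≠ 0 ∧ w' (n + 1) b ≠ 0 ∧ w' v c ≠ 0 := by
    refine ⟨?_, ?_, ?_⟩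
    · simp [w', h.expand_left]
    · simp [w', h.expand_right]
    · simp only [w', h.expand_root]; grind
  obtain ⟨t1, t2, t3⟩ := tri
  obtain ⟨e1, e2, e3⟩ := ext
  have reach : ∀ t, t < n + 2 → t ≠ p → t ≠ q →
      ∃ z, z < n ∧ z ≠ v ∧ z ≠ q ∧ ReflTransGen (AdjAvoiding w' p q) t z := by
    intro t ht htp htq
    have t1' := hw.symm n v ▸ t1
    have t2' := hw.symm (n + 1) v ▸ t2
    have t3' := hw.symm n (n + 1) ▸ t3
    by_cases htn : t < n ∧ t ≠ v
    · exact ⟨t, htn.1, htn.2, htq, .refl⟩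
    obtain rfl | rfl | rfl : t = v ∨ t = n ∨ t = n + 1 := by omega
    · by_cases hpn : p = n
      · exact step t (n + 1) c b t2' e3 e2 hcb hcn hb hcv hbv htp htq (by omega) (by omega)
      · exact step t n c a t1' e3 e1 hca hcn ha hcv hav htp htq (by omega) (by omega)
    · by_cases hpn : p = v
      · exact step t (t + 1) a b t3 e1 e2 hab ha hb hav hbv htp htq (by omega) (by omega)
      · exact step t v a c t1 e1 e3 hca.symm ha hcn hav hcv htp htq (by omega) (by omega)
    · by_cases hpn : p = v
      · exact step (n + 1) n b a t3' e2 e1 hab.symm hb ha hbv hav htp htq (by omega) (by omega)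
      · exact step (n + 1) v b c t2 e2 e3 hcb.symm hb hcn hbv hcv htp htq (by omega) (by omega)
  obtain ⟨z, hz, hzv, hzq, h4⟩ := reach x hx hxp hxq
  obtain ⟨z', hz', hzv', hzq', h5⟩ := reach y hy hyp hyq
  exact h4.trans ((outer z z' hz hz' hzv hzv' hzq hzq').trans (reflTransGen_adjAvoiding_symm hw h5))

/-- If the whole triangle survives, old walks survive as well: the edges `va` and `vb` are replaced
by paths of length two through `n` and `n + 1`. -/
theorem isThreeConnected_expand (h3 : IsThreeConnected n w) (hc : w v c ≠ 0) (hk : k ≠ 0) :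
    IsThreeConnected (n + 2) (expand n v a b k w) := by
  intro p q x y hx hy hxp hxq hyp hyq
  by_cases hp : p = v ∨ p = n ∨ p = n + 1
  · exact h.connected_expand_of_mem h3 hc hk hp hx hy hxp hxq hyp hyq
  by_cases hq : q = v ∨ q = n ∨ q = n + 1
  · rw [AdjAvoiding.comm]
    exact h.connected_expand_of_mem h3 hc hk hq hx hy hxq hxp hyq hyp
  have hv := h.v_lt; have ha := h.a_lt; have hb := h.b_lt
  have hw := h.isMultiplicity_expand (k := k)
  set w' := expand n v a b k w
  have t1 : AdjAvoiding w' p q n v :=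
    ⟨by simp [w', h.expand_left], by omega, by omega⟩
  have t2 : AdjAvoiding w' p q (n + 1) v :=
    ⟨by simp [w', h.expand_right], by omega, by omega⟩
  have va : ∀ u, (u = a ∨ u = b) → u ≠ p → u ≠ q → ReflTransGen (AdjAvoiding w' p q) v u := by
    rintro u (rfl | rfl) h1 h2
    · exact .head (t1.symm hw) (.single ⟨by simp [w', h.expand_left], by omega, h1, h2⟩)
    · exact .head (t2.symm hw) (.single ⟨by simp [w', h.expand_right], by omega, h1, h2⟩)
  have outer : ∀ x y, x < n → y < n → x ≠ p → x ≠ q → y ≠ p → y ≠ q →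
      ReflTransGen (AdjAvoiding w' p q) x y := by
    intro x y hx hy hxp hxq hyp hyq
    have hsub : ∀ x y, AdjAvoiding w p q x y → ReflTransGen (AdjAvoiding w' p q) x y := by
      rintro x y ⟨hxy, h1, h2⟩
      by_cases hvx : x = v ∧ (y = a ∨ y = b)
      · obtain ⟨rfl, h4⟩ := hvx; exact va y h4 h2.1 h2.2
      by_cases hvy : y = v ∧ (x = a ∨ x = b)
      · obtain ⟨rfl, h4⟩ := hvy
        exact reflTransGen_adjAvoiding_symm hw (va x h4 h1.1 h1.2)
      refine .single ⟨?_, h1, h2⟩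
      have hx := h.lt hxy
      have hy := h.lt' hxy
      simp only [w', expand, Sym2.eq_iff]
      grind
    have h4 := h3 p q x y hx hy hxp hxq hyp hyq
    clear hy hyp hyq
    induction h4 with
    | refl => exact .refl
    | tail _ h4 ih => exact ih.trans (hsub _ _ h4)
  have reach : ∀ t, t < n + 2 → t ≠ p → t ≠ q →
      ∃ z, z < n ∧ z ≠ p ∧ z ≠ q ∧ ReflTransGen (AdjAvoiding w' p q) t z := by
    intro t ht htp htq
    by_cases htn : t < n
    · exact ⟨t, htn, htp, htq, .refl⟩
    obtain rfl | rfl : t = n ∨ t = n + 1 := by omega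
    · exact ⟨v, hv, by omega, by omega, .single t1⟩
    · exact ⟨v, hv, by omega, by omega, .single t2⟩
  obtain ⟨z, hz, hzv, hzq, h4⟩ := reach x hx hxp hxq
  obtain ⟨z', hz', hzv', hzq', h5⟩ := reach y hy hyp hyq
  exact h4.trans ((outer z z' hz hz' hzv hzq hzv' hzq').trans (reflTransGen_adjAvoiding_symm hw h5))

omit h in
/-- Repeated expansion. -/
theorem exists_expand_list {S : Set ℕ} (L : List ℕ) (hL : ∀ d ∈ L, 2 ≤ d)
    (h : IsRooted n w v a b c) (hS : multDegree n w '' Set.Iio n = S) :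
    ∃ w' a' b', IsRooted (n + 2 * L.length) w' v a' b' c ∧
      multDegree (n + 2 * L.length) w' '' Set.Iio (n + 2 * L.length) = {d | d ∈ L} ∪ S ∧
      (IsThreeConnected n w → w v c ≠ 0 → (∀ d ∈ L, 3 ≤ d) →
        IsThreeConnected (n + 2 * L.length) w' ∧ w' v c ≠ 0) := by
  induction L with
  | nil => exact ⟨w, a, b, h, by simpa using hS, fun h3 hc _ => ⟨h3, hc⟩⟩
  | cons d L ih =>
    obtain ⟨w', a', b', h1, h2, h3⟩ := ih fun d hd => hL d (List.mem_cons_of_mem _ hd)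
    have hd := hL d List.mem_cons_self
    -- The new vertices have degree `k + 2`, so `k = d - 2`; for `d ≥ 3` this is nonzero, as
    -- 3-connectedness requires.
    refine ⟨expand (n + 2 * L.length) v a' b' (d - 2) w', _, _, h1.isRooted_expand (d - 2), ?_, ?_⟩
    · have := h1.multDegree_image_expand (k := d - 2)
      rw [h2, Nat.sub_add_cancel hd] at this
      refine Eq.trans this ?_
      ext; simp [or_assoc]
    · intro g1 g2 g3
      obtain ⟨g4, g5⟩ := h3 g1 g2 fun d hd => g3 d (List.mem_cons_of_mem _ hd)
      have := g3 d List.mem_cons_self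
      refine ⟨h1.isThreeConnected_expand g4 g5 (by omega), ?_⟩
      have := h1.ne_ca; have := h1.ne_cb; have := h1.c_lt
      rw [h1.expand_root]
      grind

end IsRooted

/-! ### From multiplicities to multigraphs -/

/-- The `i`-th edge between `x` and `y`. -/
def edgeCode (x y i : ℕ) : ℕ := Nat.pair (Nat.pair (min x y) (max x y)) i

lemma edgeCode_comm (x y i : ℕ) : edgeCode x y i = edgeCode y x i := by
  unfold edgeCode; rw [min_comm, max_comm]

lemma edgeCode_inj {x y i x' y' i' : ℕ} (h : edgeCode x y i = edgeCode x' y' i') :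
    ((x = x' ∧ y = y') ∨ (x = y' ∧ y = x')) ∧ i = i' := by
  unfold edgeCode at h
  obtain ⟨h1, h2⟩ := Nat.pair_eq_pair.1 h
  obtain ⟨h3, h4⟩ := Nat.pair_eq_pair.1 h1
  omega

/-- The multigraph with multiplicities `w`. -/
def IsMultiplicity.graph {n : ℕ} {w : ℕ → ℕ → ℕ} (hw : IsMultiplicity n w) : Graph ℕ ℕ where
  vertexSet := Set.Iio n
  IsLink e x y := ∃ i < w x y, e = edgeCode x y i
  isLink_symm := by
    rintro e -
    refine ⟨fun x y => ?_⟩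
    rintro ⟨i, hi, rfl⟩
    exact ⟨i, hw.symm x y ▸ hi, edgeCode_comm _ _ _⟩
  eq_or_eq_of_isLink_of_isLink := by
    rintro e x y x' y' ⟨i, hi, rfl⟩ ⟨j, hj, h⟩
    have := edgeCode_inj h
    omega
  left_mem_of_isLink := by
    rintro e x y ⟨i, hi, rfl⟩
    exact hw.lt (by omega : w x y ≠ 0)

/-- The cyclic successor on `0, …, n - 1`. -/
def cyclicSucc (n i : ℕ) : ℕ := if i + 1 < n then i + 1 else 0

namespace IsMultiplicity

variable {n : ℕ} {w : ℕ → ℕ → ℕ} (hw : IsMultiplicity n w)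

lemma isLink_graph {e x y : ℕ} : hw.graph.IsLink e x y ↔ ∃ i < w x y, e = edgeCode x y i := Iff.rfl

lemma vertexSet_graph : hw.graph.vertexSet = Set.Iio n := rfl

include hw in
lemma lt_right {x y : ℕ} (h : w x y ≠ 0) : y < n := hw.lt (hw.symm x y ▸ h)

lemma incidenceSet_graph (x : ℕ) : hw.graph.incidenceSet x =
    (((Finset.range n).sigma fun y => Finset.range (w x y)).image
      fun p => edgeCode x p.1 p.2 : Finset ℕ) := by
  ext e
  simp only [Graph.mem_incidenceSet, Graph.Inc, isLink_graph, Finset.coe_image, Set.mem_image,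
    Finset.mem_coe, Finset.mem_sigma, Finset.mem_range, Sigma.exists]
  constructor
  · rintro ⟨y, i, hi, rfl⟩
    exact ⟨y, i, ⟨hw.lt_right (by omega : w x y ≠ 0), hi⟩, rfl⟩
  · rintro ⟨y, i, ⟨-, hi⟩, rfl⟩
    exact ⟨y, i, hi, rfl⟩

lemma degree_graph (x : ℕ) : hw.graph.degree x = multDegree n w x := by
  rw [Graph.degree, incidenceSet_graph, Set.ncard_coe_finset, Finset.card_image_of_injOn,
    Finset.card_sigma]
  · simp [multDegree]
  · rintro ⟨y, i⟩ - ⟨y', i'⟩ - h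
    have := edgeCode_inj h
    simp only at this
    obtain rfl : y = y' := by omega
    obtain rfl : i = i' := by omega
    rfl

lemma isMultigraph_graph : hw.graph.IsMultigraph where
  finite_vertexSet := Set.finite_Iio n
  finite_edgeSet := by
    refine ((Set.finite_Iio n).biUnion fun x _ => ?_ :
      (⋃ x ∈ Set.Iio n, hw.graph.incidenceSet x).Finite).subset ?_
    · rw [incidenceSet_graph]; exact Finset.finite_toSet _
    · intro e he
      obtain ⟨x, y, h⟩ := Graph.exists_isLink_of_mem_edgeSet he
      exact Set.mem_biUnion h.left_mem ⟨y, h⟩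
  loopless := ⟨by
    rintro e x ⟨i, hi, -⟩
    rw [hw.self] at hi
    omega⟩

lemma degreeSet_graph : hw.graph.degreeSet = multDegree n w '' Set.Iio n := by
  ext d
  simp [Graph.degreeSet, degree_graph, vertexSet_graph]

/-- For `n = 2` the predecessor and the successor of a vertex would coincide; hence the bound `3 ≤
n`. -/
lemma isSpanningCycle_of_isCycleSeq (hn : 3 ≤ n) {v e : ℕ → ℕ} (h : hw.graph.IsCycleSeq n v e) :
    IsSpanningCycle n w fun x y => ∃ f ∈ e '' Set.Iio n, hw.graph.IsLink f x y := by
  have hlink : ∀ i < n, hw.graph.IsLink (e i) (v i) (v (cyclicSucc n i)) := by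
    intro i hi
    unfold cyclicSucc
    split_ifs with h1
    · exact h.link i h1
    · have : i = n - 1 := by omega
      rw [this]; exact h.link_last
  have hmem : ∀ x < n, ∃ i < n, v i = x := fun x hx => by
    have : x ∈ v '' Set.Iio n := by rw [h.image_vertex]; exact hx
    simpa using this
  refine ⟨?_, ?_, ?_, ?_⟩
  · rintro x y ⟨f, hf, hl⟩; exact ⟨f, hf, hl.symm⟩
  · rintro x y ⟨f, hf, i, hi, rfl⟩; omega
  · intro x hx
    obtain ⟨i, hi, rfl⟩ := hmem x hx
    have hs : cyclicSucc n i < n := by unfold cyclicSucc; split_ifs <;> omega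
    obtain ⟨j, hj, hji⟩ : ∃ j < n, cyclicSucc n j = i := by
      by_cases h0 : i = 0
      · exact ⟨n - 1, by omega, by unfold cyclicSucc; split_ifs <;> omega⟩
      · exact ⟨i - 1, by omega, by unfold cyclicSucc; split_ifs <;> omega⟩
    have hsucc_inj : ∀ k < n, cyclicSucc n k = i → k = j := by
      intro k hk hki
      unfold cyclicSucc at hji hki
      split_ifs at hji hki <;> omega
    refine ⟨v (cyclicSucc n i), v j, ?_, fun u => ⟨?_, ?_⟩⟩
    · intro heq
      have := h.inj_vertex hs hj heq
      unfold cyclicSucc at this hji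
      split_ifs at this hji <;> omega
    · rintro ⟨_, ⟨k, hk, rfl⟩, hl⟩
      have hk' : k < n := hk
      have hsk : cyclicSucc n k < n := by unfold cyclicSucc; split_ifs <;> omega
      rcases hl.eq_and_eq_or_eq_and_eq (hlink k hk) with ⟨h1, h2⟩ | ⟨h1, h2⟩
      · rw [h.inj_vertex hi hk h1]; exact Or.inl h2
      · have := h.inj_vertex hi hsk h1
        rw [← hsucc_inj k hk this.symm]; exact Or.inr h2
    · rintro (rfl | rfl)
      · exact ⟨e i, ⟨i, hi, rfl⟩, hlink i hi⟩
      · have := (hlink j hj).symm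
        rw [hji] at this
        exact ⟨e j, ⟨j, hj, rfl⟩, this⟩
  · have key : ∀ i < n, ReflTransGen (fun x y => ∃ f ∈ e '' Set.Iio n, hw.graph.IsLink f x y)
        (v 0) (v i) ∧ ReflTransGen (fun x y => ∃ f ∈ e '' Set.Iio n, hw.graph.IsLink f x y)
        (v i) (v 0) := by
      intro i
      induction i with
      | zero => exact fun _ => ⟨.refl, .refl⟩
      | succ i ih =>
        intro hi
        obtain ⟨h1, h2⟩ := ih (by omega)
        have hi' : i ∈ Set.Iio n := show i < n by omega
        exact ⟨h1.tail ⟨e i, ⟨i, hi', rfl⟩, h.link i hi⟩,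
          .head ⟨e i, ⟨i, hi', rfl⟩, (h.link i hi).symm⟩ h2⟩
    intro x hx y hy
    obtain ⟨i, hi, rfl⟩ := hmem x hx
    obtain ⟨j, hj, rfl⟩ := hmem y hy
    exact (key i hi).2.trans (key j hj).1

lemma isCycleSeq_graph (hn : 3 ≤ n) {v : ℕ → ℕ} (hv : Set.InjOn v (Set.Iio n))
    (him : v '' Set.Iio n = Set.Iio n) (h1 : ∀ i < n, w (v i) (v (cyclicSucc n i)) = 1) :
    hw.graph.IsCycleSeq n v fun i => edgeCode (v i) (v (cyclicSucc n i)) 0 where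
  two_le := by omega
  inj_vertex := hv
  image_vertex := him
  inj_edge := by
    intro i hi j hj hij
    have hi' : i < n := hi
    have hj' : j < n := hj
    have hsi : cyclicSucc n i < n := by unfold cyclicSucc; split_ifs <;> omega
    have hsj : cyclicSucc n j < n := by unfold cyclicSucc; split_ifs <;> omega
    rcases (edgeCode_inj hij).1 with ⟨h2, -⟩ | ⟨h2, h3⟩
    · exact hv hi hj h2
    · have h4 := hv hi hsj h2
      have h5 := hv hsi hj h3
      unfold cyclicSucc at h4 h5
      split_ifs at h4 h5 <;> omega
  link := by
    intro i hi
    have := h1 i (by omega)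
    simp only [cyclicSucc, if_pos hi] at this ⊢
    exact ⟨0, by omega, rfl⟩
  link_last := by
    have := h1 (n - 1) (by omega)
    have h2 : cyclicSucc n (n - 1) = 0 := by unfold cyclicSucc; split_ifs <;> omega
    simp only [h2] at this ⊢
    exact ⟨0, by omega, rfl⟩

lemma isKConnected_three (hn : 3 < n) (h3 : IsThreeConnected n w) : hw.graph.IsKConnected 3 := by
  refine ⟨?_, fun X hX => ⟨?_, ?_⟩⟩
  · rw [vertexSet_graph, Set.encard_eq_coe_toFinset_card]
    simpa using hn
  · obtain ⟨x, hx, hxX⟩ := Finset.exists_mem_notMem_of_card_lt_card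
      (show X.card < (Finset.range n).card by rw [Finset.card_range]; omega)
    exact ⟨x, by simpa [vertexSet_graph] using ⟨Finset.mem_range.1 hx, hxX⟩⟩
  -- If fewer than two vertices are deleted, `p` and `q` coincide; the non-vertex `n` stands for no
  -- deletion.
  · obtain ⟨p, q, hpq, hpq'⟩ : ∃ p q, (∀ x ∈ X, x = p ∨ x = q) ∧ ∀ x < n, x ∉ X → x ≠ p ∧ x ≠ q := by
      have : X.card = 0 ∨ X.card = 1 ∨ X.card = 2 := by omega
      rcases this with h | h | h
      · rw [Finset.card_eq_zero] at h
        exact ⟨n, n, by simp [h], by intros; omega⟩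
      · obtain ⟨p, rfl⟩ := Finset.card_eq_one.1 h
        exact ⟨p, p, by simp, by simp⟩
      · obtain ⟨p, q, -, rfl⟩ := Finset.card_eq_two.1 h
        exact ⟨p, q, by simp, by simp⟩
    simp only [Graph.vertexSet_deleteVerts, vertexSet_graph, Set.mem_sdiff, Set.mem_Iio,
      Finset.mem_coe]
    rintro x ⟨hx, hxX⟩ y ⟨hy, hyX⟩
    obtain ⟨h1, h2⟩ := hpq' x hx hxX
    obtain ⟨h4, h5⟩ := hpq' y hy hyX
    refine ReflTransGen.mono ?_ x y (h3 p q x y hx hy h1 h2 h4 h5)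
    rintro x y ⟨hxy, ⟨h6, h7⟩, h8, h9⟩
    refine ⟨edgeCode x y 0, ?_⟩
    rw [Graph.deleteVerts_isLink]
    refine ⟨⟨0, by omega, rfl⟩, fun h => ?_, fun h => ?_⟩
    · rcases hpq x h with rfl | rfl <;> contradiction
    · rcases hpq y h with rfl | rfl <;> contradiction

lemma isKConnected_two (hn : 3 ≤ n) {v e : ℕ → ℕ} (h : hw.graph.IsCycleSeq n v e) :
    hw.graph.IsKConnected 2 := by
  have hmem : ∀ x < n, ∃ i < n, v i = x := fun x hx => by
    have : x ∈ v '' Set.Iio n := by rw [h.image_vertex]; exact hx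
    simpa using this
  refine ⟨?_, fun X hX => ⟨?_, ?_⟩⟩
  · rw [vertexSet_graph, Set.encard_eq_coe_toFinset_card]
    simpa using (show 2 < n by omega)
  · obtain ⟨x, hx, hxX⟩ := Finset.exists_mem_notMem_of_card_lt_card
      (show X.card < (Finset.range n).card by rw [Finset.card_range]; omega)
    exact ⟨x, by simpa [vertexSet_graph] using ⟨Finset.mem_range.1 hx, hxX⟩⟩
  -- The index `j = n` means that no vertex of the graph is deleted.
  · obtain ⟨j, hj⟩ : ∃ j, ∀ i < n, v i ∈ X ↔ i = j := by
      have : X.card = 0 ∨ X.card = 1 := by omega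
      rcases this with h0 | h0
      · rw [Finset.card_eq_zero] at h0
        exact ⟨n, by intro i hi; simp only [h0, Finset.notMem_empty, false_iff]; omega⟩
      · obtain ⟨p, rfl⟩ := Finset.card_eq_one.1 h0
        by_cases hp : p < n
        · obtain ⟨j, hjn, rfl⟩ := hmem p hp
          refine ⟨j, fun i hi => ?_⟩
          rw [Finset.mem_singleton]
          exact ⟨fun h1 => h.inj_vertex hi hjn h1, fun h1 => h1 ▸ rfl⟩
        · refine ⟨n, fun i hi => ?_⟩
          have : v i < n := by
            have : v i ∈ v '' Set.Iio n := ⟨i, hi, rfl⟩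
            rw [h.image_vertex] at this; exact this
          rw [Finset.mem_singleton]
          omega
    set H := hw.graph.deleteVerts (X : Set ℕ)
    have symm : ∀ {x y}, ReflTransGen H.Adj x y → ReflTransGen H.Adj y x := by
      intro x y hxy
      induction hxy with
      | refl => exact .refl
      | tail _ h1 ih => exact .head h1.symm ih
    have step : ∀ i, i + 1 < n → i ≠ j → i + 1 ≠ j → H.Adj (v i) (v (i + 1)) := by
      intro i hi h1 h2
      refine ⟨e i, ?_⟩
      rw [Graph.deleteVerts_isLink, Finset.mem_coe, Finset.mem_coe, hj i (by omega), hj _ hi]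
      exact ⟨h.link i hi, h1, h2⟩
    have step_last : j ≠ 0 → j ≠ n - 1 → H.Adj (v (n - 1)) (v 0) := by
      intro h1 h2
      refine ⟨e (n - 1), ?_⟩
      rw [Graph.deleteVerts_isLink, Finset.mem_coe, Finset.mem_coe, hj _ (by omega),
        hj _ (by omega)]
      exact ⟨h.link_last, h2.symm, h1.symm⟩
    have down : ∀ i < n, i < j → ReflTransGen H.Adj (v i) (v 0) := by
      intro i
      induction i with
      | zero => exact fun _ _ => .refl
      | succ i ih =>
        intro h1 h2
        exact .head (step i h1 (by omega) (by omega)).symm (ih (by omega) (by omega))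
    have up : ∀ k i, i + k + 1 = n → j < i → ReflTransGen H.Adj (v i) (v (n - 1)) := by
      intro k
      induction k with
      | zero => rintro i h1 -; rw [show i = n - 1 by omega]
      | succ k ih =>
        intro i h1 h2
        exact .head (step i (by omega) (by omega) (by omega)) (ih (i + 1) (by omega) (by omega))
    -- The cycle without `v j` is a path, and all its vertices reach `v 0`, or `v (n - 1)` if `v 0`
    -- is the deleted one.
    have hub : ∀ i < n, i ≠ j → ReflTransGen H.Adj (v i) (v (if j = 0 then n - 1 else 0)) := by
      intro i hi hij
      rcases Nat.lt_or_ge i j with h1 | h1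
      · rw [if_neg (by omega)]; exact down i hi h1
      · have h2 := up (n - 1 - i) i (by omega) (by omega)
        split_ifs with h0
        · exact h2
        · exact h2.tail (step_last h0 (by omega))
    simp only [H, Graph.vertexSet_deleteVerts, vertexSet_graph, Set.mem_sdiff, Set.mem_Iio,
      Finset.mem_coe]
    rintro x ⟨hx, hxX⟩ y ⟨hy, hyX⟩
    obtain ⟨i, hi, rfl⟩ := hmem x hx
    obtain ⟨k, hk, rfl⟩ := hmem y hy
    rw [hj i hi] at hxX
    rw [hj k hk] at hyX
    exact (hub i hi hxX).trans (symm (hub k hk hyX))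

lemma not_isIsomorphic {n' : ℕ} {w' : ℕ → ℕ → ℕ} (hw' : IsMultiplicity n' w') (hne : n ≠ n') :
    ¬ hw.graph.IsIsomorphic hw'.graph := by
  rintro ⟨f, -⟩
  have := Nat.card_congr f
  simp [vertexSet_graph] at this
  exact hne this

end IsMultiplicity

namespace IsRooted

variable {n : ℕ} {w : ℕ → ℕ → ℕ} {v a b c : ℕ} (h : IsRooted n w v a b c)
include h

lemma three_le : 3 ≤ n := by
  have := h.v_lt; have := h.a_lt; have := h.b_lt; have := h.a_ne; have := h.b_ne
  have := h.ne_ab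
  omega

lemma exists_isCycleSeq : ∃ u, h.toIsMultiplicity.graph.IsCycleSeq n u
    (fun i => edgeCode (u i) (u (cyclicSucc n i)) 0) ∧
    ∀ i < n, w (u i) (u (cyclicSucc n i)) = 1 := by
  obtain ⟨m, hnd, hmem, hch⟩ := h.cycle
  have hn := h.three_le
  set l := v :: (b :: m ++ [a]) with hl
  have hch' : l.IsChain (fun x y => w x y = 1) := by
    rw [hl, List.cons_append, List.isChain_cons_cons]
    exact ⟨h.right, hch⟩
  have hlen : l.length = n := by
    rw [← List.toFinset_card_of_nodup hnd, show l.toFinset = Finset.range n by ext x; simp [hmem],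
      Finset.card_range]
  have hget : ∀ i (hi : i < n), l.getD i 0 = l[i]'(by omega) := fun i hi =>
    List.getD_eq_getElem _ _ _
  have h1 : ∀ i < n, w (l.getD i 0) (l.getD (cyclicSucc n i) 0) = 1 := by
    intro i hi
    unfold cyclicSucc
    split_ifs with h1
    · rw [hget i hi, hget (i + 1) h1]
      exact List.isChain_iff_getElem.1 hch' i (by omega)
    · have h0 : l.getD 0 0 = v := by simp [hl]
      have h2 : l.getD i 0 = a := by
        rw [hget i hi]
        have : l.getLast (by simp [hl]) = a := by simp [hl]
        rw [List.getLast_eq_getElem] at this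
        refine Eq.trans ?_ this
        congr 1; omega
      rw [h0, h2, h.symm, h.left]
  refine ⟨fun i => l.getD i 0, h.toIsMultiplicity.isCycleSeq_graph hn ?_ ?_ h1, h1⟩
  · intro i hi j hj hij
    simp only [hget i hi, hget j hj] at hij
    exact (List.Nodup.getElem_inj_iff hnd).1 hij
  · ext x
    rw [Set.mem_Iio, ← hmem, List.mem_iff_getElem]
    constructor
    · rintro ⟨i, hi, rfl⟩
      exact ⟨i, by rw [hlen]; exact hi, (hget i hi).symm⟩
    · rintro ⟨i, hi, rfl⟩
      exact ⟨i, by rw [← hlen]; exact hi, hget i (by omega)⟩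

/-- `unique` determines the adjacent pairs on a hamiltonian cycle; since these pairs have
multiplicity one, they determine its edges. -/
theorem isUniquelyHamiltonian_graph : h.toIsMultiplicity.graph.IsUniquelyHamiltonian := by
  have hn := h.three_le
  set hw := h.toIsMultiplicity
  obtain ⟨u, hu, hu1⟩ := h.exists_isCycleSeq
  set e₀ := fun i => edgeCode (u i) (u (cyclicSucc n i)) 0
  have hw1 : ∀ f ∈ e₀ '' Set.Iio n, ∀ x y, hw.graph.IsLink f x y → w x y = 1 := by
    rintro _ ⟨i, hi, rfl⟩ x y ⟨k, hk, hf⟩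
    have := hu1 i hi
    rcases (edgeCode_inj hf).1 with ⟨h1, h2⟩ | ⟨h1, h2⟩
    · rwa [h1, h2] at this
    · rwa [h1, h2, hw.symm] at this
  have huniq : ∀ {f g x y}, w x y = 1 → hw.graph.IsLink f x y → hw.graph.IsLink g x y → f = g := by
    rintro f g x y h1 ⟨i, hi, rfl⟩ ⟨j, hj, rfl⟩
    rw [show i = j by omega]
  have hE₀ := hw.isSpanningCycle_of_isCycleSeq hn hu
  refine ⟨e₀ '' Set.Iio n, hu.isHamiltonianCycle, ?_⟩
  intro C hC
  obtain ⟨n', v', e', hs, rfl⟩ := hC.exists_isCycleSeq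
  obtain rfl : n' = n := by
    have := hs.inj_vertex.ncard_image
    rw [hs.image_vertex] at this
    simpa [hw.vertexSet_graph, ← Finset.coe_Iio, Set.ncard_coe_finset] using this.symm
  have hE := hw.isSpanningCycle_of_isCycleSeq hn hs
  ext f
  constructor
  · rintro ⟨i, hi, rfl⟩
    have hmem : e' i ∈ hw.graph.edgeSet := by
      by_cases h1 : i + 1 < n'
      · exact (hs.link i h1).edge_mem
      · have hi' : i < n' := hi
        rw [show i = n' - 1 by omega]; exact hs.link_last.edge_mem
    obtain ⟨x, y, hl⟩ := Graph.exists_isLink_of_mem_edgeSet hmem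
    obtain ⟨g, hg, hgl⟩ := h.unique hE hE₀ ⟨_, ⟨i, hi, rfl⟩, hl⟩
    rw [huniq (hw1 g hg x y hgl) hl hgl]
    exact hg
  · rintro hf
    have hmem : f ∈ hw.graph.edgeSet := by
      obtain ⟨i, hi, rfl⟩ := hf
      by_cases h1 : i + 1 < n'
      · exact (hu.link i h1).edge_mem
      · have hi' : i < n' := hi
        rw [show i = n' - 1 by omega]; exact hu.link_last.edge_mem
    obtain ⟨x, y, hl⟩ := Graph.exists_isLink_of_mem_edgeSet hmem
    obtain ⟨g, hg, hgl⟩ := h.unique hE₀ hE ⟨f, hf, hl⟩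
    rw [huniq (hw1 f hf x y hl) hl hgl]
    exact hg

theorem isUHMultigraphWithDegrees_graph {M : Finset ℕ}
    (hM : multDegree n w '' Set.Iio n = (M : Set ℕ)) :
    IsUHMultigraphWithDegrees h.toIsMultiplicity.graph M :=
  ⟨h.toIsMultiplicity.isMultigraph_graph, h.isUniquelyHamiltonian_graph, by
    rw [IsMultiplicity.degreeSet_graph, hM]⟩

end IsRooted

/-! ### A base graph with vertices of degree `2` -/

/-- The multiplicities of a triangle. -/
def triangleMult (x y : ℕ) : ℕ := if x < 3 ∧ y < 3 ∧ x ≠ y then 1 else 0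

lemma triangleMult_ne_zero {x y : ℕ} : triangleMult x y ≠ 0 ↔ x < 3 ∧ y < 3 ∧ x ≠ y := by
  unfold triangleMult; split_ifs with h <;> simp [h]

/-- Taking `c = 0`, the root itself, encodes that there is no third neighbour. -/
lemma isRooted_triangleMult : IsRooted 3 triangleMult 0 2 1 0 where
  symm x y := by unfold triangleMult; split_ifs <;> omega
  self x := by simp [triangleMult]
  lt h := (triangleMult_ne_zero.1 h).1
  nbr h := by have := triangleMult_ne_zero.1 h; omega
  left := by decide
  right := by decide
  ne_ab := by decide
  ne_ca := by decide
  ne_cb := by decide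
  c_lt := by decide
  cycle := ⟨[], by decide, by intro x; simp; omega, by simp [triangleMult]⟩
  unique := by
    intro E E' hE hE' x y hxy
    have h := triangleMult_ne_zero.1 (hE.ne_zero hxy)
    obtain ⟨y', z', hne, htwo⟩ := hE'.two x h.1
    have h1 := triangleMult_ne_zero.1 (hE'.ne_zero ((htwo y').2 (Or.inl rfl)))
    have h2 := triangleMult_ne_zero.1 (hE'.ne_zero ((htwo z').2 (Or.inr rfl)))
    rw [htwo]
    omega

lemma multDegree_image_triangleMult : multDegree 3 triangleMult '' Set.Iio 3 = {2} := by
  have h : ∀ x < 3, multDegree 3 triangleMult x = 2 := by decide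
  ext d
  simp only [Set.mem_image, Set.mem_Iio, Set.mem_singleton_iff]
  exact ⟨fun ⟨x, hx, hd⟩ => hd ▸ h x hx, fun hd => ⟨0, by omega, hd ▸ h 0 (by omega)⟩⟩

/-! ### A regular `3`-connected base graph -/

/-- The multiplicities of a cycle through `28` vertices. -/
def rimMult (x y : ℕ) : ℕ :=
  if x < 28 ∧ y < 28 ∧ (y = (x + 1) % 28 ∨ x = (y + 1) % 28) then 1 else 0

/-- Disjoint chords of the cycle. -/
def matchingChords : List (ℕ × ℕ) :=
  [(0, 9), (1, 3), (4, 10), (5, 19), (6, 8), (11, 13), (14, 23), (15, 17), (18, 24), (20, 22),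
    (25, 27)]

/-- Chords that form two triangles on the remaining vertices. -/
def triangleChords : List (ℕ × ℕ) :=
  [(2, 7), (2, 12), (7, 12), (16, 21), (16, 26), (21, 26)]

/-- Multiplicities such that each vertex has chord degree two. -/
def chordMult (x y : ℕ) : ℕ :=
  if (x, y) ∈ matchingChords ∨ (y, x) ∈ matchingChords then 2
  else if (x, y) ∈ triangleChords ∨ (y, x) ∈ triangleChords then 1 else 0

/-- The multiplicities of a multigraph in which all degrees are `2 * r + 2`. -/
def baseMult (r x y : ℕ) : ℕ := rimMult x y + r * chordMult x y

/-- The pairs of adjacent vertices of the base graph, in an order suited for the search for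
spanning cycles. -/
def baseEdges : List (ℕ × ℕ) :=
  [(15, 17), (16, 17), (17, 18), (18, 19), (18, 24), (23, 24), (24, 25), (14, 23), (22, 23),
    (20, 22), (21, 22), (5, 19), (19, 20), (20, 21), (25, 26), (25, 27), (21, 26), (16, 21),
    (16, 26), (15, 16), (14, 15), (26, 27), (13, 14), (0, 27), (0, 1), (0, 9), (4, 5), (5, 6),
    (8, 9), (9, 10), (6, 7), (6, 8), (7, 8), (3, 4), (4, 10), (10, 11), (1, 3), (2, 3), (1, 2),
    (2, 7), (7, 12), (2, 12), (11, 12), (12, 13), (11, 13)]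

/-- The neighbours of `x` along the listed edges. -/
def listNeighbors (x : ℕ) (L : List (ℕ × ℕ)) : List ℕ :=
  L.filterMap fun p => if p.1 = x then some p.2 else if p.2 = x then some p.1 else none

lemma mem_listNeighbors {x u : ℕ} {L : List (ℕ × ℕ)} (h : u ∈ listNeighbors x L) :
    (x, u) ∈ L ∨ (u, x) ∈ L := by
  simp only [listNeighbors, List.mem_filterMap, Prod.exists] at h
  obtain ⟨p, q, hpq, h⟩ := h
  split_ifs at h with h1 h2 <;> simp_all

lemma mem_listNeighbors_of_left {x u : ℕ} {L : List (ℕ × ℕ)} (h : (x, u) ∈ L) :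
    u ∈ listNeighbors x L :=
  List.mem_filterMap.2 ⟨(x, u), h, by simp⟩

lemma mem_listNeighbors_of_right {x u : ℕ} {L : List (ℕ × ℕ)} (h : (u, x) ∈ L) :
    u ∈ listNeighbors x L :=
  List.mem_filterMap.2 ⟨(u, x), h, by by_cases hux : u = x <;> simp [hux]⟩

/-- The list starts with three different elements. -/
def startsWithThree : List ℕ → Bool
  | p :: q :: r :: _ => p != q && p != r && q != r
  | _ => false

/-- The list has at most one element. -/
def isShort : List ℕ → Bool
  | [] => true
  | [_] => true
  | _ => false

/-- One round of the computation of the vertices, encoded as a bit mask, which are reachable along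
the listed edges. -/
def reachRound (L : List (ℕ × ℕ)) (S : ℕ) : ℕ :=
  L.foldl (fun S p => if S.testBit p.1 || S.testBit p.2 then S ||| 2 ^ p.1 ||| 2 ^ p.2 else S) S

/-- The edges leave the vertex `0` disconnected from some other vertex. -/
def isDisconnecting (L : List (ℕ × ℕ)) : Bool :=
  let S := (reachRound L)^[8] 1
  S.testBit 0 && L.all (fun p => S.testBit p.1 == S.testBit p.2) &&
    (List.range 28).any (fun x => !S.testBit x)

/-- A search which verifies that the rim is the only spanning cycle that uses the edges in `chosen`
and otherwise only edges in the first list. -/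
def onlyRim : List (ℕ × ℕ) → List (ℕ × ℕ) → Bool
  | [], chosen => chosen.all (fun p => p.2 == (p.1 + 1) % 28 || p.1 == (p.2 + 1) % 28) ||
      isDisconnecting chosen
  | e :: rest, chosen =>
      (isShort (listNeighbors e.1 (rest ++ chosen)) ||
        isShort (listNeighbors e.2 (rest ++ chosen)) || onlyRim rest chosen) &&
      (startsWithThree (listNeighbors e.1 (e :: chosen)) ||
        startsWithThree (listNeighbors e.2 (e :: chosen)) || onlyRim rest (e :: chosen))

/-- The test checks directly that the computed set is closed under the edges, so its soundness does
not depend on the number of rounds. -/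
lemma not_isDisconnecting {w : ℕ → ℕ → ℕ} {E : ℕ → ℕ → Prop} (hE : IsSpanningCycle 28 w E)
    {L : List (ℕ × ℕ)} (hL : ∀ x y, E x y → (x, y) ∈ L ∨ (y, x) ∈ L) : isDisconnecting L = false := by
  by_contra h
  rw [Bool.not_eq_false, isDisconnecting] at h
  generalize (reachRound L)^[8] 1 = S at h
  simp only [Bool.and_eq_true, List.all_eq_true, beq_iff_eq, List.any_eq_true, List.mem_range,
    Bool.not_eq_true'] at h
  obtain ⟨⟨h0, hS⟩, x, hx, hxS⟩ := h
  have := ReflTransGen.mem_of_closed (P := fun x => S.testBit x = true) (r := E) ?_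
    (hE.conn 0 (by omega) x hx) h0
  · rw [hxS] at this; exact absurd this (by decide)
  · intro x y hxy hxyE
    rcases hL x y hxyE with h1 | h1
    · rw [← hS _ h1]; exact hxy
    · rw [hS _ h1]; exact hxy

lemma not_isShort {w : ℕ → ℕ → ℕ} {E : ℕ → ℕ → Prop} (hE : IsSpanningCycle 28 w E)
    {L : List (ℕ × ℕ)} (hL : ∀ x y, E x y → (x, y) ∈ L ∨ (y, x) ∈ L) {x : ℕ} (hx : x < 28) :
    isShort (listNeighbors x L) = false := by
  obtain ⟨y, z, hyz, h⟩ := hE.two x hx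
  have key : ∀ u, E x u → u ∈ listNeighbors x L := fun u hu =>
    (hL x u hu).elim mem_listNeighbors_of_left mem_listNeighbors_of_right
  have h1 := key y ((h y).2 (Or.inl rfl))
  have h2 := key z ((h z).2 (Or.inr rfl))
  generalize listNeighbors x L = l at h1 h2
  match l, h1, h2 with
  | [p], h1, h2 => simp_all
  | _ :: _ :: _, _, _ => rfl

lemma not_startsWithThree {w : ℕ → ℕ → ℕ} {E : ℕ → ℕ → Prop} (hE : IsSpanningCycle 28 w E)
    {L : List (ℕ × ℕ)} (hL : ∀ p ∈ L, E p.1 p.2) {x : ℕ} (hx : x < 28) :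
    startsWithThree (listNeighbors x L) = false := by
  obtain ⟨y, z, hyz, h⟩ := hE.two x hx
  have key : ∀ u ∈ listNeighbors x L, u = y ∨ u = z := fun u hu => by
    rw [← h]
    exact (mem_listNeighbors hu).elim (fun h => hL _ h) (fun h => hE.symm (hL _ h))
  generalize listNeighbors x L = l at key
  match l, key with
  | [], _ => rfl
  | [_], _ => rfl
  | [_, _], _ => rfl
  | p :: q :: r :: _, key =>
    have h1 := key p (by simp)
    have h2 := key q (by simp)
    have h3 := key r (by simp)
    rw [startsWithThree]
    by_contra h4
    simp only [Bool.not_eq_false, Bool.and_eq_true, bne_iff_ne] at h4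
    omega

/-- Soundness of the search, by branching on whether the next edge lies on the cycle. The invariant
is that the cycle contains `chosen` and is contained in `rest ++ chosen`; pruned branches violate
2-regularity. -/
lemma rim_of_onlyRim {w : ℕ → ℕ → ℕ} {E : ℕ → ℕ → Prop} (hE : IsSpanningCycle 28 w E) :
    ∀ rest chosen, onlyRim rest chosen = true → (∀ p ∈ rest, p.1 < 28 ∧ p.2 < 28) →
      (∀ p ∈ chosen, E p.1 p.2) →
      (∀ x y, E x y → (x, y) ∈ rest ++ chosen ∨ (y, x) ∈ rest ++ chosen) →
      ∀ x y, E x y → y = (x + 1) % 28 ∨ x = (y + 1) % 28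
  | [], chosen, h, _, _, h2, x, y, hxy => by
    rw [List.nil_append] at h2
    rw [onlyRim, not_isDisconnecting hE h2, Bool.or_false, List.all_eq_true] at h
    rcases h2 x y hxy with h3 | h3
    · simpa using h _ h3
    · simpa [or_comm] using h _ h3
  | e :: rest, chosen, h, hlt, h1, h2, x, y, hxy => by
    have he := hlt e List.mem_cons_self
    have hlt' : ∀ p ∈ rest, p.1 < 28 ∧ p.2 < 28 := fun p hp => hlt p (List.mem_cons_of_mem _ hp)
    rw [onlyRim, Bool.and_eq_true] at h
    by_cases hc : E e.1 e.2
    · have h3 : ∀ p ∈ e :: chosen, E p.1 p.2 := by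
        intro p hp
        rcases List.mem_cons.1 hp with rfl | hp
        · exact hc
        · exact h1 p hp
      have h4 := h.2
      rw [not_startsWithThree hE h3 he.1, not_startsWithThree hE h3 he.2, Bool.false_or,
        Bool.false_or] at h4
      refine rim_of_onlyRim hE rest _ h4 hlt' h3 (fun x y hxy => ?_) x y hxy
      have := h2 x y hxy
      simp only [List.cons_append, List.mem_cons, List.mem_append] at this ⊢
      tauto
    · have h3 : ∀ x y, E x y → (x, y) ∈ rest ++ chosen ∨ (y, x) ∈ rest ++ chosen := by
        intro x y hxy
        rcases h2 x y hxy with h5 | h5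
        · rcases List.mem_cons.1 h5 with rfl | h5
          · exact absurd hxy hc
          · exact Or.inl h5
        · rcases List.mem_cons.1 h5 with rfl | h5
          · exact absurd (hE.symm hxy) hc
          · exact Or.inr h5
      have h4 := h.1
      rw [not_isShort hE h3 he.1, not_isShort hE h3 he.2, Bool.false_or, Bool.false_or] at h4
      exact rim_of_onlyRim hE rest _ h4 hlt' h1 h3 x y hxy

/-- Only the underlying simple graph enters, so one computation serves all `r ≠ 0`. -/
lemma onlyRim_baseEdges : onlyRim baseEdges [] = true := by decide +kernel

section base
variable {r x y : ℕ}

lemma rimMult_symm : rimMult x y = rimMult y x := by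
  unfold rimMult; split_ifs <;> omega

lemma chordMult_symm : chordMult x y = chordMult y x := by
  unfold chordMult; simp only [or_comm]

lemma lt_of_chordMult_ne_zero (h : chordMult x y ≠ 0) : x < 28 ∧ y < 28 := by
  have h1 : ∀ p ∈ matchingChords ++ triangleChords, p.1 < 28 ∧ p.2 < 28 := by decide
  unfold chordMult at h
  split_ifs at h with h2 h3
  · rcases h2 with h2 | h2
    · exact h1 _ (List.mem_append_left _ h2)
    · exact (h1 _ (List.mem_append_left _ h2)).symm
  · rcases h3 with h2 | h2
    · exact h1 _ (List.mem_append_right _ h2)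
    · exact (h1 _ (List.mem_append_right _ h2)).symm
  · omega

lemma lt_of_rimMult_ne_zero (h : rimMult x y ≠ 0) : x < 28 ∧ y < 28 := by
  unfold rimMult at h; split_ifs at h <;> omega

lemma baseMult_ne_zero (hr : r ≠ 0) : baseMult r x y ≠ 0 ↔ rimMult x y ≠ 0 ∨ chordMult x y ≠ 0 := by
  have : r * chordMult x y = 0 ↔ chordMult x y = 0 := by simp [hr]
  unfold baseMult
  omega

lemma mem_baseEdges : ∀ x ∈ List.range 28, ∀ y ∈ List.range 28, (rimMult x y ≠ 0 ∨ chordMult x y ≠ 0) →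
    (x, y) ∈ baseEdges ∨ (y, x) ∈ baseEdges := by decide +kernel

lemma isMultiplicity_baseMult (hr : r ≠ 0) : IsMultiplicity 28 (baseMult r) where
  symm x y := by unfold baseMult; rw [rimMult_symm, chordMult_symm]
  self x := by
    have h : ∀ x < 28, rimMult x x = 0 ∧ chordMult x x = 0 := by decide +kernel
    by_contra h0
    rcases (baseMult_ne_zero hr).1 h0 with h1 | h1
    · exact h1 (h x (lt_of_rimMult_ne_zero h1).1).1
    · exact h1 (h x (lt_of_chordMult_ne_zero h1).1).2
  lt {x y} h := by
    rcases (baseMult_ne_zero hr).1 h with h1 | h1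
    · exact (lt_of_rimMult_ne_zero h1).1
    · exact (lt_of_chordMult_ne_zero h1).1

lemma rim_of_isSpanningCycle (hr : r ≠ 0) {E : ℕ → ℕ → Prop}
    (hE : IsSpanningCycle 28 (baseMult r) E) (hxy : E x y) :
    y = (x + 1) % 28 ∨ x = (y + 1) % 28 := by
  refine rim_of_onlyRim hE baseEdges [] onlyRim_baseEdges (by decide) (by simp) ?_ x y hxy
  intro x y hxy
  have hw := isMultiplicity_baseMult hr
  have h := hE.ne_zero hxy
  simpa using mem_baseEdges x (List.mem_range.2 (hw.lt h)) y (List.mem_range.2 (hw.lt_right h))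
    ((baseMult_ne_zero hr).1 h)

/-- No chord is parallel to a rim edge, so the rim stays simple for every `r`. Any spanning cycle
lies in the rim and, being 2-regular, equals it. -/
lemma isRooted_baseMult (hr : r ≠ 0) : IsRooted 28 (baseMult r) 0 27 1 9 where
  toIsMultiplicity := isMultiplicity_baseMult hr
  nbr {x} h := by
    have h1 : ∀ x < 28, (rimMult 0 x ≠ 0 ∨ chordMult 0 x ≠ 0) → x = 27 ∨ x = 1 ∨ x = 9 := by
      decide +kernel
    exact h1 x ((isMultiplicity_baseMult hr).lt_right h) ((baseMult_ne_zero hr).1 h)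
  left := by
    have : rimMult 0 27 = 1 ∧ chordMult 0 27 = 0 := by decide
    simp [baseMult, this]
  right := by
    have : rimMult 0 1 = 1 ∧ chordMult 0 1 = 0 := by decide
    simp [baseMult, this]
  ne_ab := by decide
  ne_ca := by decide
  ne_cb := by decide
  c_lt := by decide
  cycle := by
    refine ⟨List.range' 2 25, by decide, ?_, ?_⟩
    · intro x
      rw [show 0 :: (1 :: List.range' 2 25 ++ [27]) = List.range 28 by decide, List.mem_range]
    · have h : (1 :: List.range' 2 25 ++ [27]).IsChain
          (fun x y => rimMult x y = 1 ∧ chordMult x y = 0) := by decide +kernel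
      exact h.imp fun x y h => by simp [baseMult, h]
  unique {E E'} hE hE' x y hxy := by
    have h1 := rim_of_isSpanningCycle hr hE hxy
    have hw := isMultiplicity_baseMult hr
    have hx := hw.lt (hE.ne_zero hxy)
    have hy := hw.lt_right (hE.ne_zero hxy)
    obtain ⟨y', z', hne, htwo⟩ := hE'.two x hx
    have hy' := (htwo y').2 (Or.inl rfl)
    have hz' := (htwo z').2 (Or.inr rfl)
    have h2 := rim_of_isSpanningCycle hr hE' hy'
    have h3 := rim_of_isSpanningCycle hr hE' hz'
    have := hw.lt_right (hE'.ne_zero hy')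
    have := hw.lt_right (hE'.ne_zero hz')
    rw [htwo]
    omega

lemma multDegree_image_baseMult (r : ℕ) :
    multDegree 28 (baseMult r) '' Set.Iio 28 = {2 * r + 2} := by
  have h : ∀ x < 28, multDegree 28 rimMult x = 2 ∧ multDegree 28 chordMult x = 2 := by
    decide +kernel
  have h1 : ∀ x < 28, multDegree 28 (baseMult r) x = 2 * r + 2 := by
    intro x hx
    obtain ⟨h1, h2⟩ := h x hx
    unfold multDegree at *
    simp only [baseMult, Finset.sum_add_distrib, ← Finset.mul_sum, h1, h2]
    ring
  ext d
  simp only [Set.mem_image, Set.mem_Iio, Set.mem_singleton_iff]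
  exact ⟨fun ⟨x, hx, hd⟩ => hd ▸ h1 x hx, fun hd => ⟨0, by omega, hd ▸ h1 0 (by omega)⟩⟩

/-- Every vertex marked by a round is truly reachable; that enough vertices are marked is left to
computation. -/
lemma reflTransGen_of_reachRound {w : ℕ → ℕ → ℕ} {p q s : ℕ} (hw : IsMultiplicity 28 w)
    {L : List (ℕ × ℕ)} (hL : ∀ e ∈ L, AdjAvoiding w p q e.1 e.2) {S : ℕ}
    (hS : ∀ x, S.testBit x = true → ReflTransGen (AdjAvoiding w p q) s x) :
    ∀ x, (reachRound L S).testBit x = true → ReflTransGen (AdjAvoiding w p q) s x := by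
  unfold reachRound
  induction L generalizing S with
  | nil => exact hS
  | cons e L ih =>
    refine ih (fun e he => hL e (List.mem_cons_of_mem _ he)) ?_
    intro x hx
    have hadj := hL e List.mem_cons_self
    dsimp only at hx
    split_ifs at hx with h
    · rw [Bool.or_eq_true] at h
      have h12 : ReflTransGen (AdjAvoiding w p q) s e.1 ∧
          ReflTransGen (AdjAvoiding w p q) s e.2 := by
        rcases h with h | h
        · exact ⟨hS _ h, (hS _ h).tail hadj⟩
        · exact ⟨(hS _ h).tail (hadj.symm hw), hS _ h⟩
      simp only [Nat.testBit_or, Nat.testBit_two_pow, Bool.or_eq_true, decide_eq_true_eq] at hx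
      rcases hx with (hx | rfl) | rfl
      · exact hS x hx
      · exact h12.1
      · exact h12.2
    · exact hS x hx

/-- The adjacent pairs in an order in which connectedness is quickly detected. -/
def sweepEdges : List (ℕ × ℕ) :=
  let rim := (List.range 28).map fun i => (i, (i + 1) % 28)
  rim ++ matchingChords ++ triangleChords ++ rim.reverse

/-- The vertices which are found from `s` after the deletion of `p` and `q`. -/
def reachAvoiding (p q s : ℕ) : ℕ :=
  (reachRound (sweepEdges.filter fun e => e.1 != p && e.1 != q && (e.2 != p && e.2 != q)))^[2]
    (2 ^ s)

lemma isThreeConnected_baseMult (hr : r ≠ 0) : IsThreeConnected 28 (baseMult r) := by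
  have hw := isMultiplicity_baseMult hr
  -- The value `28` stands for no deletion. One of the starts `0, 1, 2` survives, as at most two
  -- vertices are deleted.
  have hcheck : ∀ p ∈ List.range 29, ∀ q ∈ List.range 29, ∃ s ∈ List.range 3, ∀ x ∈ List.range 28,
      x ≠ p → x ≠ q → (reachAvoiding p q s).testBit x = true := by decide +kernel
  have hsweep : ∀ e ∈ sweepEdges, rimMult e.1 e.2 ≠ 0 ∨ chordMult e.1 e.2 ≠ 0 := by decide +kernel
  have main : ∀ p < 29, ∀ q < 29, ∀ x y, x < 28 → y < 28 → x ≠ p → x ≠ q → y ≠ p → y ≠ q →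
      ReflTransGen (AdjAvoiding (baseMult r) p q) x y := by
    intro p hp q hq x y hx hy hxp hxq hyp hyq
    obtain ⟨s, -, hs⟩ := hcheck p (List.mem_range.2 hp) q (List.mem_range.2 hq)
    have hL : ∀ e ∈ sweepEdges.filter fun e => e.1 != p && e.1 != q && (e.2 != p && e.2 != q),
        AdjAvoiding (baseMult r) p q e.1 e.2 := by
      intro e he
      rw [List.mem_filter] at he
      refine ⟨(baseMult_ne_zero hr).2 (hsweep e he.1), ?_⟩
      simpa using he.2
    have hreach := reflTransGen_of_reachRound hw hL
      (reflTransGen_of_reachRound hw hL (S := 2 ^ s) (s := s) (by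
        intro x hx
        rw [Nat.testBit_two_pow, decide_eq_true_eq] at hx
        rw [hx]))
    exact (reflTransGen_adjAvoiding_symm hw (hreach x (hs x (List.mem_range.2 hx) hxp hxq))).trans
      (hreach y (hs y (List.mem_range.2 hy) hyp hyq))
  intro p q x y hx hy hxp hxq hyp hyq
  refine ReflTransGen.mono ?_ x y (main (min p 28) (by omega) (min q 28) (by omega) x y hx hy
    (by omega) (by omega) (by omega) (by omega))
  rintro x y ⟨hxy, ⟨h1, h2⟩, h3, h4⟩
  have := hw.lt hxy
  have := hw.lt_right hxy
  exact ⟨hxy, ⟨by omega, by omega⟩, by omega, by omega⟩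

end base

/-! ### The main theorem -/

/-- The graphs have different numbers of vertices, so they are pairwise non-isomorphic. -/
lemma infinitelyManyKConnectedUH_of_forall {k n : ℕ} {M : Finset ℕ}
    (h : ∀ i : ℕ, ∃ w, ∃ hw : IsMultiplicity (n + 2 * i) w,
      IsUHMultigraphWithDegrees hw.graph M ∧ hw.graph.IsKConnected k) :
    InfinitelyManyKConnectedUH k M := by
  choose w hw h using h
  exact ⟨fun i => (hw i).graph, h, fun i j hij => (hw i).not_isIsomorphic (hw j) (by omega)⟩

/-- The `i` extra copies of `d` enlarge the graph without changing its degree set. -/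
lemma setOf_mem_toList_append_replicate {M : Finset ℕ} {d : ℕ} (hd : d ∈ M) (i : ℕ) :
    {e | e ∈ M.toList ++ List.replicate i d} ∪ {d} = (M : Set ℕ) := by
  ext e
  simp only [List.mem_append, Finset.mem_toList, List.mem_replicate, Set.mem_union,
    Set.mem_ofPred_eq, Set.mem_singleton_iff, Finset.mem_coe]
  constructor
  · rintro ((h | ⟨-, rfl⟩) | rfl) <;> assumption
  · exact fun h => Or.inl (Or.inl h)

lemma forall_mem_toList_append_replicate {M : Finset ℕ} {d : ℕ} (hd : d ∈ M) (i : ℕ)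
    {P : ℕ → Prop} (hP : ∀ d ∈ M, P d) : ∀ e ∈ M.toList ++ List.replicate i d, P e := by
  intro e he
  rw [List.mem_append, Finset.mem_toList, List.mem_replicate] at he
  rcases he with he | ⟨-, rfl⟩
  · exact hP _ he
  · exact hP _ hd

theorem infinitelyManyKConnectedUH_two {M : Finset ℕ} (hM : ∀ d ∈ M, 2 ≤ d) (h2 : 2 ∈ M) :
    InfinitelyManyKConnectedUH 2 M := by
  refine infinitelyManyKConnectedUH_of_forall (n := 3 + 2 * M.card) fun i => ?_
  obtain ⟨w, a, b, h, hdeg, -⟩ := IsRooted.exists_expand_list (M.toList ++ List.replicate i 2)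
    (forall_mem_toList_append_replicate h2 i hM) isRooted_triangleMult multDegree_image_triangleMult
  rw [setOf_mem_toList_append_replicate h2] at hdeg
  rw [List.length_append, Finset.length_toList, List.length_replicate, mul_add, ← add_assoc]
    at h hdeg
  obtain ⟨u, hu, -⟩ := h.exists_isCycleSeq
  exact ⟨w, h.toIsMultiplicity, h.isUHMultigraphWithDegrees_graph hdeg,
    h.toIsMultiplicity.isKConnected_two h.three_le hu⟩

theorem infinitelyManyKConnectedUH_three {M : Finset ℕ} (hM : ∀ d ∈ M, 2 ≤ d) (h2 : 2 ∉ M)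
    (heven : ∃ d ∈ M, Even d) : InfinitelyManyKConnectedUH 3 M := by
  have hM3 : ∀ d ∈ M, 3 ≤ d := fun d hd => by
    rcases (hM d hd).lt_or_eq with h | rfl
    · exact h
    · exact absurd hd h2
  obtain ⟨d, hd, hde⟩ := heven
  -- Here `r ≠ 0` because the even degree `d` is at least `4`.
  obtain ⟨r, hr, rfl⟩ : ∃ r, r ≠ 0 ∧ d = 2 * r + 2 := by
    obtain ⟨k, rfl⟩ := hde
    have := hM3 _ hd
    exact ⟨k - 1, by omega, by omega⟩
  refine infinitelyManyKConnectedUH_of_forall (n := 28 + 2 * M.card) fun i => ?_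
  obtain ⟨w, a, b, h, hdeg, hconn⟩ :=
    IsRooted.exists_expand_list (M.toList ++ List.replicate i (2 * r + 2))
      (forall_mem_toList_append_replicate hd i hM) (isRooted_baseMult hr)
      (multDegree_image_baseMult r)
  have hc : baseMult r 0 9 ≠ 0 := by
    have : chordMult 0 9 ≠ 0 := by decide
    exact (baseMult_ne_zero hr).2 (Or.inr this)
  have h3 := (hconn (isThreeConnected_baseMult hr) hc
    (forall_mem_toList_append_replicate hd i hM3)).1
  rw [setOf_mem_toList_append_replicate hd] at hdeg
  rw [List.length_append, Finset.length_toList, List.length_replicate, mul_add, ← add_assoc]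
    at h hdeg h3
  exact ⟨w, h.toIsMultiplicity, h.isUHMultigraphWithDegrees_graph hdeg,
    h.toIsMultiplicity.isKConnected_three (by omega) h3⟩

lemma exists_even_of_isUHMultigraphWithDegrees {α β : Type*} {G : Graph α β} {M : Finset ℕ}
    (h : IsUHMultigraphWithDegrees G M) : ∃ d ∈ M, Even d := by
  obtain ⟨hG, huniq, hdeg⟩ := h
  by_contra! hodd
  refine hG.not_isUniquelyHamiltonian (fun x hx => ?_) huniq
  have : G.degree x ∈ G.degreeSet := ⟨x, hx, rfl⟩
  rw [hdeg] at this
  exact Nat.not_even_iff_odd.1 (hodd _ this)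

theorem corollary3p11 (M : Finset ℕ) (hM : ∀ d ∈ M, 2 ≤ d) :
    ((∃ (α β : Type) (G : Graph α β), IsUHMultigraphWithDegrees G M) ↔ ∃ d ∈ M, Even d) ∧
    ((∃ d ∈ M, Even d) →
      (2 ∉ M → InfinitelyManyKConnectedUH 3 M) ∧
      (2 ∈ M → InfinitelyManyKConnectedUH 2 M)) := by
  refine ⟨⟨?_, fun heven => ?_⟩, fun heven =>
    ⟨fun h2 => infinitelyManyKConnectedUH_three hM h2 heven,
      fun h2 => infinitelyManyKConnectedUH_two hM h2⟩⟩
  · rintro ⟨α, β, G, h⟩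
    exact exists_even_of_isUHMultigraphWithDegrees h
  · by_cases h2 : 2 ∈ M
    · obtain ⟨G, hG, -⟩ := infinitelyManyKConnectedUH_two hM h2
      exact ⟨ℕ, ℕ, G 0, (hG 0).1⟩
    · obtain ⟨G, hG, -⟩ := infinitelyManyKConnectedUH_three hM h2 heven
      exact ⟨ℕ, ℕ, G 0, (hG 0).1⟩
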